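/- A planar network of rank $n$ is a finite graph embedded in a strip $0\le x\le r$ ($r>0$) whose edges are never vertical (each edge is the graph of a continuous function of $x$, oriented from left to right, and edges meet only at common endpoints), having exactly $n$ vertices on the line $x=0$ (the sources) and exactly $n$ vertices on the line $x=r$ (the sinks), both labelled $1,\dots,n$ from bottom to top. A tropical weighting $w$ of $\Pi$ assigns to every edge an element of $\mathbb{T}=\mathbb{R}\cup\{-\infty\}$. The concatenation $\Pi_1\circ\cdots\circ\Pi_k$ is obtained by gluing the sink of $\Pi_s$ with label $h$ to the source of $\Pi_{s+1}$ with label $h$; weightings $w_s$ of the $\Pi_s$ give the weighting $w_1\circ\cdots\circ w_k$ of it. For $\underline\alpha=(\alpha_1,\dots,\alpha_k)\in\mathbb{Z}_{\ge0}^k$ with $\sum_s\alpha_s\le n$, an $\underline\alpha$-multipath $p=(p_1,\dots,p_k)$ consists, for each $s$, of a set $p_s$ of $\alpha_s$ oriented paths in $\Pi_1\circ\cdots\circ\Pi_s$, each going from a source to a sink of $\Pi_1\circ\cdots\circ\Pi_s$, such that all the paths in $p_1,\dots,p_k$ are pairwise vertex-disjoint. Its weight $w(p)$ is the sum of the weights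 of all edges of its paths. Let $m_{\underline\alpha}$ be the maximum of $w(p)$ over all $\underline\alpha$-multipaths $p$ ($-\infty$ if there are none). The weighted concatenation $(\Pi_1\circ\cdots\circ\Pi_k,w_1\circ\cdots\circ w_k)$ satisfies the multi-Gelfand–Zeitlin condition if for every such $\underline\alpha$ there is an $\underline\alpha$-multipath $p$ of maximal weight whose set of sources is $\{n-\sum_s\alpha_s+1,\dots,n\}$ and for which the set of sinks of $p_s$ is $\{1,\dots,\alpha_s\}$ for each $s$. Theorem. Let $\Pi_1,\Pi_2,\Pi_3$ be planar networks of rank $n$ with tropical weightings $w_1,w_2,w_3$ such that $(\Pi_s,w_s)$ for $s=1,2,3$ (with $k=1$), $(\Pi_1\circ\Pi_2,w_1\circ w_2)$ and $(\Pi_2\circ\Pi_3,w_2\circ w_3)$ (with $k=2$), and $(\Pi_1\circ\Pi_2\circ\Pi_3,w_1\circ w_2\circ w_3)$ (with $k=3$) all satisfy the multi-Gelfand–Zeitlin condition. Then the numbers $m_{i,j,k}=m_{(i,j,k)}$ of $(\Pi_1\circ\Pi_2\circ\Pi_3,w_1\circ w_2\circ w_3)$ satisfy, for all integers $i,j,k\ge0$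 with $i+j+k+2\le n$, the tropical octahedron recurrence $$m_{i,j+1,k}+m_{i+1,j,k+1}=\max\{m_{i+1,j,k}+m_{i,j+1,k+1},\; m_{i,j,k+1}+m_{i+1,j+1,k}\}.$$ -/

import Mathlib

/-- A planar network of rank `n`: a finite graph drawn in the strip `0 ≤ x ≤ width`.
Vertices are points of the plane.  Edges are never vertical: the edge `e`, oriented from left to
right, is the graph of the continuous function `curve e` over the interval between the abscissas
of its two endpoints.  Edges meet one another and the vertices only at endpoints.  The vertices on
the left border of the strip (the sources) and on the right border (the sinks) are labelled
`1, …, n` from bottom to top; they are placed at the heights `1, …, n`, so that the sinks of one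
network can be glued to the sources of the next one.  The drawing being finite, it is
contained in a bounded horizontal strip, whose size plays no role and is not prescribed. -/
structure PlanarNetwork (n : ℕ) where
  width : ℝ
  width_pos : 0 < width
  vertices : Finset (ℝ × ℝ)
  Edge : Type
  edge_finite : Finite Edge
  src : Edge → ℝ × ℝ
  tgt : Edge → ℝ × ℝ
  curve : Edge → ℝ → ℝ
  vertices_strip : ∀ v ∈ vertices, v.1 ∈ Set.Icc 0 width
  left_border : ∀ y : ℝ, (0, y) ∈ vertices ↔ ∃ h ∈ Finset.Icc 1 n, y = (h : ℝ)
  right_border : ∀ y : ℝ, (width, y) ∈ vertices ↔ ∃ h ∈ Finset.Icc 1 n, y = (h : ℝ)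
  src_mem : ∀ e, src e ∈ vertices
  tgt_mem : ∀ e, tgt e ∈ vertices
  src_lt_tgt : ∀ e, (src e).1 < (tgt e).1
  curve_continuous : ∀ e, ContinuousOn (curve e) (Set.Icc (src e).1 (tgt e).1)
  curve_src : ∀ e, curve e (src e).1 = (src e).2
  curve_tgt : ∀ e, curve e (tgt e).1 = (tgt e).2
  edges_disjoint : ∀ e e', e ≠ e' → ∀ x ∈ Set.Ioo (src e).1 (tgt e).1,
    x ∈ Set.Ioo (src e').1 (tgt e').1 → curve e x ≠ curve e' x
  edge_avoids_vertices : ∀ e, ∀ v ∈ vertices, v.1 ∈ Set.Ioo (src e).1 (tgt e).1 →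
    curve e v.1 ≠ v.2

namespace PlanarNetwork

attribute [instance] edge_finite

variable {n k : ℕ}

/-- A weighting with values in the tropical numbers `ℝ ∪ {-∞}`, the tropical sum being the
maximum and the tropical product the usual addition. -/
abbrev Weighting (N : PlanarNetwork n) : Type := N.Edge → WithBot ℝ

/-- The abscissa of the `i`-th vertical line (`0 ≤ i ≤ k`) of the concatenation of
`N 0, …, N (k - 1)`: the line `0` carries the sources of the concatenation, and the line `i + 1`
carries the sinks of `N i`. -/
noncomputable def vertical (N : Fin k → PlanarNetwork n) (i : ℕ) : ℝ :=
  ∑ j ∈ Finset.univ.filter (fun j : Fin k => j.val < i), (N j).width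

/-- The edges of the concatenation of `N 0, …, N (k - 1)`. -/
abbrev CEdge (N : Fin k → PlanarNetwork n) : Type := Σ i : Fin k, (N i).Edge

/-- The left endpoint of an edge in the concatenation, where `N i` is drawn between the vertical
lines `i` and `i + 1`. -/
noncomputable def csrc (N : Fin k → PlanarNetwork n) (e : CEdge N) : ℝ × ℝ :=
  (vertical N e.1 + ((N e.1).src e.2).1, ((N e.1).src e.2).2)

/-- The right endpoint of an edge in the concatenation. -/
noncomputable def ctgt (N : Fin k → PlanarNetwork n) (e : CEdge N) : ℝ × ℝ :=
  (vertical N e.1 + ((N e.1).tgt e.2).1, ((N e.1).tgt e.2).2)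

/-- `IsPath N u v l`: the successive edges in `l` form an oriented path from `u` to `v` in the
concatenation. -/
def IsPath (N : Fin k → PlanarNetwork n) : ℝ × ℝ → ℝ × ℝ → List (CEdge N) → Prop
  | u, v, [] => u = v
  | u, v, e :: l => csrc N e = u ∧ IsPath N (ctgt N e) v l

/-- `l` is a path in the concatenation of `N 0, …, N i` from its source with label `a` to its sink
with label `b` (which lies on the vertical line `i + 1`). -/
def Connects (N : Fin k → PlanarNetwork n) (i : Fin k) (a b : ℕ) (l : List (CEdge N)) : Prop :=
  a ∈ Finset.Icc 1 n ∧ b ∈ Finset.Icc 1 n ∧ (∀ e ∈ l, e.1 ≤ i) ∧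
    IsPath N (0, (a : ℝ)) (vertical N (i + 1), (b : ℝ)) l

/-- The vertices through which a path goes. -/
def pathVertices (N : Fin k → PlanarNetwork n) (l : List (CEdge N)) : Set (ℝ × ℝ) :=
  {v | ∃ e ∈ l, v = csrc N e ∨ v = ctgt N e}

/-- An `α`-multipath in the concatenation of `N 0, …, N (k - 1)`: for every `i`, a set of `α i`
paths in the concatenation of `N 0, …, N i` from its sources to its sinks; all these paths, for
all `i` together, are pairwise non-intersecting. -/
structure Multipath (N : Fin k → PlanarNetwork n) (α : Fin k → ℕ) where
  paths : Fin k → Finset (List (CEdge N))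
  card_paths : ∀ i, (paths i).card = α i
  connects : ∀ i, ∀ l ∈ paths i, ∃ a b : ℕ, Connects N i a b l
  nonintersecting : ∀ i j, ∀ l ∈ paths i, ∀ l' ∈ paths j, (i, l) ≠ (j, l') →
    Disjoint (pathVertices N l) (pathVertices N l')

namespace Multipath

variable {N : Fin k → PlanarNetwork n} {α : Fin k → ℕ}

/-- The labels of the sources of a multipath. -/
def sources (p : Multipath N α) : Set ℕ :=
  {a | ∃ i, ∃ l ∈ p.paths i, ∃ b, Connects N i a b l}

/-- The labels of the sinks of the `i`-th part of a multipath. -/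
def sinks (p : Multipath N α) (i : Fin k) : Set ℕ :=
  {b | ∃ l ∈ p.paths i, ∃ a, Connects N i a b l}

/-- The weight of a multipath: the tropical product of the weights of its edges. -/
noncomputable def weight (w : ∀ i, (N i).Weighting) (p : Multipath N α) : WithBot ℝ :=
  ∑ i, ∑ l ∈ p.paths i, (l.map fun e => w e.1 e.2).sum

end Multipath

theorem csrc_lt_ctgt (N : Fin k → PlanarNetwork n) (e : CEdge N) :
    (csrc N e).1 < (ctgt N e).1 := by
  have := (N e.1).src_lt_tgt e.2
  simp only [csrc, ctgt]
  linarith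

theorem IsPath.le_and_nodup (N : Fin k → PlanarNetwork n) :
    ∀ (l : List (CEdge N)) (u v : ℝ × ℝ), IsPath N u v l →
      (∀ e ∈ l, u.1 ≤ (csrc N e).1) ∧ l.Nodup
  | [], _, _, _ => by simp
  | e :: l, u, v, h => by
    obtain ⟨rfl, h2⟩ := h
    obtain ⟨h3, h4⟩ := IsPath.le_and_nodup N l _ _ h2
    have h5 := csrc_lt_ctgt N e
    refine ⟨fun f hf => ?_, List.nodup_cons.2 ⟨fun hmem => ?_, h4⟩⟩
    · rcases List.mem_cons.1 hf with rfl | hf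
      · exact le_rfl
      · exact h5.le.trans (h3 f hf)
    · exact absurd (h3 e hmem) (not_le.2 h5)

/-- There are finitely many multipaths. -/
instance Multipath.finite (N : Fin k → PlanarNetwork n) (α : Fin k → ℕ) :
    Finite (Multipath N α) := by
  classical
  have hfin : ({l : List (CEdge N) | l.Nodup}).Finite := by
    have := Fintype.ofFinite (CEdge N)
    exact Set.finite_coe_iff.1
      (Finite.of_fintype {l : List (CEdge N) // l.Nodup})
  refine Finite.of_injective
    (β := Fin k → {s : Finset (List (CEdge N)) // s ∈ hfin.toFinset.powerset})
    (fun p i => ⟨p.paths i, Finset.mem_powerset.2 fun l hl => ?_⟩) ?_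
  · obtain ⟨a, b, _, _, _, h⟩ := p.connects i l hl
    exact hfin.mem_toFinset.2 (IsPath.le_and_nodup N l _ _ h).2
  · rintro ⟨p, _, _, _⟩ ⟨q, _, _, _⟩ h
    have : p = q := funext fun i => congrArg Subtype.val (congrFun h i)
    subst this
    rfl

/-- The number `m_α`: the maximal weight of an `α`-multipath, `-∞` if there is none. -/
noncomputable def m (N : Fin k → PlanarNetwork n) (w : ∀ i, (N i).Weighting) (α : Fin k → ℕ) :
    WithBot ℝ :=
  letI := Fintype.ofFinite (Multipath N α)
  (Finset.univ : Finset (Multipath N α)).sup fun p => p.weight w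

/-- The multi-Gelfand–Zeitlin condition for the weighted concatenation of `N 0, …, N (k - 1)`:
for every `α` with `∑ i, α i ≤ n` there is an `α`-multipath of maximal weight with sources
`[n - ∑ i, α i + 1, n]` and sinks `[1, α i]`. -/
def MultiGZ (N : Fin k → PlanarNetwork n) (w : ∀ i, (N i).Weighting) : Prop :=
  ∀ α : Fin k → ℕ, ∑ i, α i ≤ n → ∃ p : Multipath N α,
    (∀ q : Multipath N α, q.weight w ≤ p.weight w) ∧
    p.sources = Set.Icc (n - ∑ i, α i + 1) n ∧ ∀ i, p.sinks i = Set.Icc 1 (α i)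

end PlanarNetwork

/-! By the multi-Gelfand–Zeitlin condition, `m` at `α` is the weight of some family of disjoint
paths from the highest sources to the lowest sinks of each line, and every such family has weight at
most `m`. Each inequality therefore follows by taking optimal families `R` and `B` for the two terms
of one sum and exchanging parts of them, with total weight preserved, to obtain families for the two
terms of another sum. Families are handled as edge sets (`IsLinkage`), with a formal edge without
target attached to each sink; `IsSwitch` lists local conditions under which an exchange is
legitimate.

For `≤`, take `R` for `(i, j+1, k)` and `B` for `(i+1, j, k+1)`. Exchange along the alternating walk
that starts at the extra sink of `R`, runs backward on `R` and forward on `B`. The new version of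
`R` has as many sinks as sources, so exactly one extra sink of `B` was exchanged, and the two
possibilities are the two terms of the maximum. The heights of the curves play no role here.

For `≥`, planarity is essential. The level of an edge `e` compares how many edges of `B` and of `R`
lie above `e`; it is constant along `e` (`IsGZ.aboveL_eq`). Edges of `R` and `B` entering, or
leaving, a common vertex have equal levels, and a path through a vertex avoided by the other family
keeps its level there. So all edges of one level can be exchanged, except for level `1`, the level
of the edge at the one source used by `B` and not by `R` (`isSwitch_levelSet`). The extra sinks on
the three lines have levels `2, 2, 1` when `R` is of type `(i+1, j, k)`, and `1, 0, 0` when it is of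
type `(i, j, k+1)`. Exchanging level `2`, respectively `0`, moves exactly the right pair of sinks.
-/

/-! ### Disjoint path systems in a directed graph and their exchanges -/

section Linkage

variable {E P : Type*}

/-- A system of disjoint paths in a directed graph, seen as a finite set of edges.  The paths start
at the points of `U` and finish with edges without target. -/
structure IsLinkage (src : E → P) (tgt : E → Option P) (A : Finset E) (U : Finset P) : Prop where
  src_inj : ∀ e ∈ A, ∀ f ∈ A, src e = src f → e = f
  tgt_inj : ∀ e ∈ A, ∀ f ∈ A, ∀ v, tgt e = some v → tgt f = some v → e = f
  source : ∀ v ∈ U, ∀ e ∈ A, tgt e ≠ some v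
  balance : ∀ v, (∃ e ∈ A, src e = v) ↔ v ∈ U ∨ ∃ e ∈ A, tgt e = some v

/-- The parts `X` of `R` and `Y` of `B` can be exchanged: near each vertex, they contain either
none or all of the edges that are connected by the symmetric difference of `R` and `B`. -/
structure IsSwitch (src : E → P) (tgt : E → Option P) (R B : Finset E) (U V : Finset P)
    (X Y : Set E) : Prop where
  src_iff : ∀ r ∈ R, ∀ b ∈ B, src r = src b → (r ∈ X ↔ b ∈ Y)
  tgt_iff : ∀ r ∈ R, ∀ b ∈ B, ∀ v, tgt r = some v → tgt b = some v → (r ∈ X ↔ b ∈ Y)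
  left : ∀ r ∈ R, ∀ r' ∈ R, tgt r = some (src r') → (∀ b ∈ B, src b ≠ src r') → (r ∈ X ↔ r' ∈ X)
  right : ∀ b ∈ B, ∀ b' ∈ B, tgt b = some (src b') → (∀ r ∈ R, src r ≠ src b') →
    (b ∈ Y ↔ b' ∈ Y)
  start_left : ∀ r ∈ R, src r ∈ U → src r ∉ V → r ∉ X
  start_right : ∀ b ∈ B, src b ∈ V → src b ∉ U → b ∉ Y

variable {src : E → P} {tgt : E → Option P} {R B A : Finset E} {U V : Finset P} {X Y : Set E}

theorem IsSwitch.symm (h : IsSwitch src tgt R B U V X Y) : IsSwitch src tgt B R V U Y X where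
  src_iff r hr b hb hrb := (h.src_iff b hb r hr hrb.symm).symm
  tgt_iff r hr b hb v h1 h2 := (h.tgt_iff b hb r hr v h2 h1).symm
  left := h.right
  right := h.left
  start_left := h.start_right
  start_right := h.start_left

open Classical in
/-- The edges of `R` after the exchange of its part `X` with the part `Y` of `B`. -/
noncomputable def switch (R B : Finset E) (X Y : Set E) : Finset E :=
  R.filter (· ∉ X) ∪ B.filter (· ∈ Y)

theorem mem_switch {e : E} : e ∈ switch R B X Y ↔ (e ∈ R ∧ e ∉ X) ∨ (e ∈ B ∧ e ∈ Y) := by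
  simp [switch]

/-- Everything is checked at one vertex. If both systems pass through it, the two entering edges
share their fate, and so do the two leaving edges, so degrees are unaffected. If only one system
passes, `left` and `right` make its entering and leaving edges move together. At a source of only
one system, `start_left` and `start_right` forbid the exchange. -/
theorem IsLinkage.switch (hR : IsLinkage src tgt R U) (hB : IsLinkage src tgt B V)
    (hUB : ∀ v ∈ U, ∀ b ∈ B, tgt b ≠ some v) (hVR : ∀ v ∈ V, ∀ r ∈ R, tgt r ≠ some v)
    (h : IsSwitch src tgt R B U V X Y) : IsLinkage src tgt (switch R B X Y) U where
  src_inj e he f hf hef := by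
    rw [mem_switch] at he hf
    rcases he with ⟨he, heX⟩ | ⟨he, heX⟩ <;> rcases hf with ⟨hf, hfX⟩ | ⟨hf, hfX⟩
    · exact hR.src_inj e he f hf hef
    · exact absurd ((h.src_iff e he f hf hef).2 hfX) heX
    · exact absurd ((h.src_iff f hf e he hef.symm).2 heX) hfX
    · exact hB.src_inj e he f hf hef
  tgt_inj e he f hf v hev hfv := by
    rw [mem_switch] at he hf
    rcases he with ⟨he, heX⟩ | ⟨he, heX⟩ <;> rcases hf with ⟨hf, hfX⟩ | ⟨hf, hfX⟩
    · exact hR.tgt_inj e he f hf v hev hfv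
    · exact absurd ((h.tgt_iff e he f hf v hev hfv).2 hfX) heX
    · exact absurd ((h.tgt_iff f hf e he v hfv hev).2 heX) hfX
    · exact hB.tgt_inj e he f hf v hev hfv
  source v hv e he := by
    rw [mem_switch] at he
    rcases he with ⟨he, -⟩ | ⟨he, -⟩
    · exact hR.source v hv e he
    · exact hUB v hv e he
  balance v := by
    simp only [mem_switch]
    have h1 := hR.balance v
    have h2 := hB.balance v
    constructor
    · rintro ⟨e, ⟨he, heX⟩ | ⟨he, heX⟩, rfl⟩
      · rcases h1.1 ⟨e, he, rfl⟩ with h3 | ⟨r, hr, hre⟩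
        · exact Or.inl h3
        · by_cases hb : ∃ b ∈ B, src b = src e
          · obtain ⟨b, hb, hbe⟩ := hb
            -- `B` leaves this vertex and `R` enters it; since no edge of `R` enters `V`, the vertex
            -- is not a source of `B`, so `B` enters it as well.
            have : src e ∉ V := fun hV => hVR _ hV r hr hre
            obtain ⟨b', hb', hbe'⟩ := (h2.1 ⟨b, hb, hbe⟩).resolve_left this
            by_cases hrX : r ∈ X
            · exact Or.inr ⟨b', Or.inr ⟨hb', (h.tgt_iff r hr b' hb' _ hre hbe').1 hrX⟩, hbe'⟩
            · exact Or.inr ⟨r, Or.inl ⟨hr, hrX⟩, hre⟩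
          · push Not at hb
            exact Or.inr ⟨r, Or.inl ⟨hr, fun hX => heX ((h.left r hr e he hre hb).1 hX)⟩, hre⟩
      · by_cases hU : src e ∈ U
        · exact Or.inl hU
        · have hV : src e ∉ V := fun hV => h.start_right e he hV hU heX
          obtain ⟨b, hb, hbe⟩ := (h2.1 ⟨e, he, rfl⟩).resolve_left hV
          by_cases hr : ∃ r ∈ R, src r = src e
          · obtain ⟨r', hr', hre'⟩ := (h1.1 hr).resolve_left hU
            by_cases hrX : r' ∈ X
            · exact Or.inr ⟨b, Or.inr ⟨hb, (h.tgt_iff r' hr' b hb _ hre' hbe).1 hrX⟩, hbe⟩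
            · exact Or.inr ⟨r', Or.inl ⟨hr', hrX⟩, hre'⟩
          · push Not at hr
            exact Or.inr ⟨b, Or.inr ⟨hb, (h.right b hb e he hbe hr).2 heX⟩, hbe⟩
    · rintro (hU | ⟨e, ⟨he, heX⟩ | ⟨he, heX⟩, hev⟩)
      · obtain ⟨r, hr, rfl⟩ := h1.2 (Or.inl hU)
        by_cases hrX : r ∈ X
        · have hV : src r ∈ V := by
            by_contra hV
            exact h.start_left r hr hU hV hrX
          obtain ⟨b, hb, hbr⟩ := h2.2 (Or.inl hV)
          exact ⟨b, Or.inr ⟨hb, (h.src_iff r hr b hb hbr.symm).1 hrX⟩, hbr⟩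
        · exact ⟨r, Or.inl ⟨hr, hrX⟩, rfl⟩
      · obtain ⟨r, hr, rfl⟩ := h1.2 (Or.inr ⟨e, he, hev⟩)
        by_cases hrX : r ∈ X
        · by_cases hb : ∃ b ∈ B, src b = src r
          · obtain ⟨b, hb, hbr⟩ := hb
            exact ⟨b, Or.inr ⟨hb, (h.src_iff r hr b hb hbr.symm).1 hrX⟩, hbr⟩
          · push Not at hb
            exact absurd ((h.left e he r hr hev hb).2 hrX) heX
        · exact ⟨r, Or.inl ⟨hr, hrX⟩, rfl⟩
      · obtain ⟨b, hb, rfl⟩ := h2.2 (Or.inr ⟨e, he, hev⟩)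
        by_cases hbY : b ∈ Y
        · exact ⟨b, Or.inr ⟨hb, hbY⟩, rfl⟩
        · by_cases hr : ∃ r ∈ R, src r = src b
          · obtain ⟨r, hr, hrb⟩ := hr
            exact ⟨r, Or.inl ⟨hr, fun hX => hbY ((h.src_iff r hr b hb hrb).1 hX)⟩, hrb⟩
          · push Not at hr
            exact absurd ((h.right e he b hb hev hr).1 heX) hbY

/-- No edge is lost or merged in the unions: `src_iff` applied to an edge common to `R` and `B`,
paired with itself, puts it in both of `X`, `Y` or in neither. -/
theorem IsSwitch.sum_add_sum {M : Type*} [AddCommMonoid M] (h : IsSwitch src tgt R B U V X Y)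
    (w : E → M) :
    ∑ e ∈ switch R B X Y, w e + ∑ e ∈ switch B R Y X, w e = ∑ e ∈ R, w e + ∑ e ∈ B, w e := by
  classical
  have h1 : Disjoint (R.filter (· ∉ X)) (B.filter (· ∈ Y)) := by
    refine Finset.disjoint_left.2 fun e he he' => ?_
    rw [Finset.mem_filter] at he he'
    exact he.2 ((h.src_iff e he.1 e he'.1 rfl).2 he'.2)
  have h2 : Disjoint (B.filter (· ∉ Y)) (R.filter (· ∈ X)) := by
    refine Finset.disjoint_left.2 fun e he he' => ?_
    rw [Finset.mem_filter] at he he'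
    exact he.2 ((h.src_iff e he'.1 e he.1 rfl).1 he'.2)
  have h3 : _root_.switch R B X Y = R.filter (· ∉ X) ∪ B.filter (· ∈ Y) := by
    ext e; simp [mem_switch]
  have h4 : _root_.switch B R Y X = B.filter (· ∉ Y) ∪ R.filter (· ∈ X) := by
    ext e; simp [mem_switch]
  rw [h3, h4, Finset.sum_union h1, Finset.sum_union h2,
    ← Finset.sum_filter_add_sum_filter_not R (· ∈ X),
    ← Finset.sum_filter_add_sum_filter_not B (· ∈ Y)]
  abel

/-- One step of an alternating walk, forward on the edges of `B` (on the right) and backward on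
those of `R` (on the left). -/
inductive AltStep (src : E → P) (tgt : E → Option P) (R B : Finset E) : E ⊕ E → E ⊕ E → Prop
  | turnTgt (b r : E) (v : P) (hb : b ∈ B) (hr : r ∈ R) (h1 : tgt b = some v)
      (h2 : tgt r = some v) : AltStep src tgt R B (.inr b) (.inl r)
  | forward (b b' : E) (hb : b ∈ B) (hb' : b' ∈ B) (h1 : tgt b = some (src b'))
      (h2 : ∀ r ∈ R, src r ≠ src b') : AltStep src tgt R B (.inr b) (.inr b')
  | turnSrc (r b : E) (hr : r ∈ R) (hb : b ∈ B) (h1 : src r = src b) :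
      AltStep src tgt R B (.inl r) (.inr b)
  | backward (r r' : E) (hr : r ∈ R) (hr' : r' ∈ R) (h1 : tgt r' = some (src r))
      (h2 : ∀ b ∈ B, src b ≠ src r) : AltStep src tgt R B (.inl r) (.inl r')

/-- The edges on the alternating walk from an edge of `R` without target form a switch. -/
theorem isSwitch_altStep (hR : IsLinkage src tgt R U) (hB : IsLinkage src tgt B V) (hUV : U ⊆ V)
    (hVR : ∀ v ∈ V, ∀ r ∈ R, tgt r ≠ some v) {r₀ : E} (h₀ : tgt r₀ = none) :
    IsSwitch src tgt R B U V
      {r | Relation.ReflTransGen (AltStep src tgt R B) (.inl r₀) (.inl r)}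
      {b | Relation.ReflTransGen (AltStep src tgt R B) (.inl r₀) (.inr b)} where
  src_iff r hr b hb hrb := by
    refine ⟨fun h => h.tail (.turnSrc r b hr hb hrb), fun h => ?_⟩
    -- Membership also propagates against the walk, because every edge has at most one predecessor
    -- on it and the initial edge, lacking a target, has none. The same argument serves for all the
    -- fields.
    rcases Relation.ReflTransGen.cases_tail h with h | ⟨z, hz, hzb⟩
    · cases h
    · cases hzb with
      | forward b' _ hb' _ h1 h2 => exact absurd hrb (h2 r hr)
      | turnSrc r' _ hr' _ h1 => rwa [hR.src_inj r' hr' r hr (h1.trans hrb.symm)] at hz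
  tgt_iff r hr b hb v hrv hbv := by
    refine ⟨fun h => ?_, fun h => h.tail (.turnTgt b r v hb hr hbv hrv)⟩
    rcases Relation.ReflTransGen.cases_tail h with h | ⟨z, hz, hzb⟩
    · cases h
      simp [h₀] at hrv
    · cases hzb with
      | turnTgt b' _ v' hb' _ h1 h2 =>
        obtain rfl : v' = v := Option.some.inj (h2.symm.trans hrv)
        rwa [hB.tgt_inj b' hb' b hb v' h1 hbv] at hz
      | backward r' _ hr' _ h1 h2 =>
        obtain rfl : src r' = v := Option.some.inj (h1.symm.trans hrv)
        obtain ⟨b', hb', h3⟩ := (hB.balance _).2 (Or.inr ⟨b, hb, hbv⟩)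
        exact absurd h3 (h2 b' hb')
  left r hr r' hr' h1 h2 := by
    refine ⟨fun h => ?_, fun h => h.tail (.backward r' r hr' hr h1 h2)⟩
    rcases Relation.ReflTransGen.cases_tail h with h | ⟨z, hz, hzb⟩
    · cases h
      simp [h₀] at h1
    · cases hzb with
      | turnTgt b _ v hb _ h3 h4 =>
        obtain rfl : v = src r' := Option.some.inj (h4.symm.trans h1)
        obtain ⟨b', hb', h5⟩ := (hB.balance _).2 (Or.inr ⟨b, hb, h3⟩)
        exact absurd h5 (h2 b' hb')
      | backward r'' _ hr'' _ h3 h4 =>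
        rwa [hR.src_inj r'' hr'' r' hr' (Option.some.inj (h3.symm.trans h1))] at hz
  right b hb b' hb' h1 h2 := by
    refine ⟨fun h => h.tail (.forward b b' hb hb' h1 h2), fun h => ?_⟩
    rcases Relation.ReflTransGen.cases_tail h with h | ⟨z, hz, hzb⟩
    · cases h
    · cases hzb with
      | forward b'' _ hb'' _ h3 h4 => rwa [hB.tgt_inj b'' hb'' b hb _ h3 h1] at hz
      | turnSrc r _ hr _ h3 => exact absurd h3 (h2 r hr)
  start_left r _ h1 h2 := absurd (hUV h1) h2
  start_right b hb h1 h2 h := by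
    rcases Relation.ReflTransGen.cases_tail h with h | ⟨z, hz, hzb⟩
    · cases h
    · cases hzb with
      | forward b' _ hb' _ h3 h4 => exact hB.source _ h1 b' hb' h3
      | turnSrc r _ hr _ h3 =>
        obtain ⟨r', hr', h4⟩ := ((hR.balance _).1 ⟨r, hr, h3⟩).resolve_left h2
        exact hVR _ h1 r' hr' h4

-- Conservation of flow: the local balance summed over the vertices satisfying `p`. All later counts
-- come from a choice of `p`.
open Classical in
theorem IsLinkage.card_filter_src (h : IsLinkage src tgt A U) (p : P → Prop) :
    (A.filter fun e => p (src e)).card =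
      (U.filter p).card + (A.filter fun e => ∃ v, tgt e = some v ∧ p v).card := by
  have h1 : (A.filter fun e => p (src e)).card = ((A.image src).filter p).card := by
    rw [Finset.filter_image, Finset.card_image_of_injOn]
    exact fun e he f hf => h.src_inj e (Finset.mem_filter.1 he).1 f (Finset.mem_filter.1 hf).1
  -- The default value of `getD` is never taken, since the filtered edges have a target.
  have h2 : (A.filter fun e => ∃ v, tgt e = some v ∧ p v).card =
      ((A.filter fun e => ∃ v, tgt e = some v ∧ p v).image
        fun e => (tgt e).getD (src e)).card := by
    rw [Finset.card_image_of_injOn]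
    intro e he f hf hef
    rw [Finset.mem_coe, Finset.mem_filter] at he hf
    obtain ⟨he, v, hv, -⟩ := he
    obtain ⟨hf, v', hv', -⟩ := hf
    simp only [hv, hv', Option.getD_some] at hef
    exact h.tgt_inj e he f hf v hv (hef ▸ hv')
  rw [h1, h2, ← Finset.card_union_of_disjoint]
  · congr 1
    ext v
    have := h.balance v
    simp only [Finset.mem_filter, Finset.mem_image, Finset.mem_union]
    rw [this]
    constructor
    · rintro ⟨hv | ⟨e, he, hev⟩, hp⟩
      · exact Or.inl ⟨hv, hp⟩
      · exact Or.inr ⟨e, ⟨he, v, hev, hp⟩, by simp [hev]⟩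
    · rintro (⟨hv, hp⟩ | ⟨e, ⟨he, v', hev, hp⟩, rfl⟩)
      · exact ⟨Or.inl hv, hp⟩
      · simp only [hev, Option.getD_some]
        exact ⟨Or.inr ⟨e, he, hev⟩, hp⟩
  · refine Finset.disjoint_left.2 fun v hv hv' => ?_
    obtain ⟨e, he, rfl⟩ := Finset.mem_image.1 hv'
    obtain ⟨he, v', hv', -⟩ := Finset.mem_filter.1 he
    rw [hv', Option.getD_some] at hv
    exact h.source _ (Finset.mem_filter.1 hv).1 e he hv'

end Linkage

/-! ### Vertical lines of the concatenation, and decomposition of edge sets into paths -/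

namespace PlanarNetwork

variable {n k : ℕ} {N : Fin k → PlanarNetwork n}

theorem vertical_zero (N : Fin k → PlanarNetwork n) : vertical N 0 = 0 := by
  simp [vertical]

theorem vertical_succ (N : Fin k → PlanarNetwork n) (q : Fin k) :
    vertical N (q + 1) = vertical N q + (N q).width := by
  have : Finset.univ.filter (fun j : Fin k => j.val < q.val + 1) =
      insert q (Finset.univ.filter fun j : Fin k => j.val < q.val) := by
    ext j
    simp only [Finset.mem_filter, Finset.mem_univ, true_and, Finset.mem_insert, Fin.ext_iff]
    omega
  rw [vertical, this, Finset.sum_insert (by simp), add_comm, vertical]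

theorem vertical_mono (N : Fin k → PlanarNetwork n) : Monotone (vertical N) := by
  intro i j hij
  refine Finset.sum_le_sum_of_subset_of_nonneg (fun q hq => ?_) fun q _ _ => (N q).width_pos.le
  simp only [Finset.mem_filter, Finset.mem_univ, true_and] at hq ⊢
  omega

theorem vertical_lt (N : Fin k → PlanarNetwork n) (q : Fin k) {j : ℕ} (h : q.val < j) :
    vertical N q < vertical N j := by
  have h1 := vertical_succ N q
  have h2 := vertical_mono N (Nat.succ_le_of_lt h)
  have h3 := (N q).width_pos
  simp only [Nat.succ_eq_add_one] at h2
  linarith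

theorem vertical_nonneg (N : Fin k → PlanarNetwork n) (i : ℕ) : 0 ≤ vertical N i :=
  vertical_zero N ▸ vertical_mono N (Nat.zero_le i)

theorem vertical_succ_pos (N : Fin k → PlanarNetwork n) (q : Fin k) :
    0 < vertical N (q + 1) :=
  (vertical_nonneg N q).trans_lt (vertical_lt N q (Nat.lt_succ_self _))

theorem vertical_succ_le_iff (p q : Fin k) :
    vertical N (p + 1) ≤ vertical N (q + 1) ↔ p ≤ q := by
  constructor
  · intro h
    by_contra! h'
    have h1 := vertical_lt N p (Nat.lt_succ_self _)
    have h2 := vertical_mono N (show q.val + 1 ≤ p.val from h')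
    simp only [Nat.succ_eq_add_one] at h1
    linarith
  · exact fun h => vertical_mono N (Nat.succ_le_succ h)

theorem vertical_succ_injective {p q : Fin k}
    (h : vertical N (p + 1) = vertical N (q + 1)) : p = q :=
  le_antisymm ((vertical_succ_le_iff p q).1 h.le) ((vertical_succ_le_iff q p).1 h.ge)

theorem vertical_le_csrc (e : CEdge N) : vertical N e.1 ≤ (csrc N e).1 := by
  have := ((N e.1).vertices_strip _ ((N e.1).src_mem e.2)).1
  simp only [csrc]
  linarith

theorem ctgt_le_vertical (e : CEdge N) : (ctgt N e).1 ≤ vertical N (e.1 + 1) := by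
  have := ((N e.1).vertices_strip _ ((N e.1).tgt_mem e.2)).2
  rw [vertical_succ]
  simp only [ctgt]
  linarith

theorem csrc_nonneg (e : CEdge N) : 0 ≤ (csrc N e).1 :=
  (vertical_nonneg N _).trans (vertical_le_csrc e)

theorem ctgt_pos (e : CEdge N) : 0 < (ctgt N e).1 :=
  (csrc_nonneg e).trans_lt (csrc_lt_ctgt N e)

/-! ### Paths -/

theorem IsPath.append_singleton : ∀ {l : List (CEdge N)} {u v : ℝ × ℝ} {e : CEdge N},
    IsPath N u v l → csrc N e = v → IsPath N u (ctgt N e) (l ++ [e])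
  | [], _, _, _, h, h' => by cases h; exact ⟨h', rfl⟩
  | _ :: _, _, _, _, h, h' => ⟨h.1, h.2.append_singleton h'⟩

theorem IsPath.csrc_eq : ∀ {l : List (CEdge N)} {u v : ℝ × ℝ} {e : CEdge N},
    IsPath N u v l → e ∈ l → csrc N e = u ∨ ∃ f ∈ l, ctgt N f = csrc N e
  | g :: l, _, _, e, h, he => by
    rcases List.mem_cons.1 he with rfl | he
    · exact Or.inl h.1
    · rcases h.2.csrc_eq he with h1 | ⟨f, hf, h1⟩
      · exact Or.inr ⟨g, List.mem_cons_self, h1.symm⟩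
      · exact Or.inr ⟨f, List.mem_cons_of_mem _ hf, h1⟩

theorem IsPath.exists_first : ∀ {l : List (CEdge N)} {u v : ℝ × ℝ},
    IsPath N u v l → u ≠ v → ∃ e ∈ l, csrc N e = u
  | [], _, _, h, h' => absurd h h'
  | e :: _, _, _, h, _ => ⟨e, List.mem_cons_self, h.1⟩

theorem IsPath.eq_or_exists_first : ∀ {l : List (CEdge N)} {u v : ℝ × ℝ},
    IsPath N u v l → u = v ∨ ∃ e ∈ l, csrc N e = u
  | [], _, _, h => Or.inl h
  | e :: _, _, _, h => Or.inr ⟨e, List.mem_cons_self, h.1⟩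

theorem IsPath.ctgt_eq : ∀ {l : List (CEdge N)} {u v : ℝ × ℝ} {e : CEdge N},
    IsPath N u v l → e ∈ l → ctgt N e = v ∨ ∃ f ∈ l, csrc N f = ctgt N e
  | g :: l, _, _, e, h, he => by
    rcases List.mem_cons.1 he with rfl | he
    · rcases h.2.eq_or_exists_first with h1 | ⟨f, hf, h1⟩
      · exact Or.inl h1
      · exact Or.inr ⟨f, List.mem_cons_of_mem _ hf, h1⟩
    · rcases h.2.ctgt_eq he with h1 | ⟨f, hf, h1⟩
      · exact Or.inl h1
      · exact Or.inr ⟨f, List.mem_cons_of_mem _ hf, h1⟩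

theorem IsPath.exists_last : ∀ {l : List (CEdge N)} {u v : ℝ × ℝ},
    IsPath N u v l → l ≠ [] → ∃ e ∈ l, ctgt N e = v
  | [], _, _, _, h' => absurd rfl h'
  | [e], _, _, h, _ => ⟨e, List.mem_cons_self, h.2⟩
  | _ :: f :: l, _, _, h, _ => by
    obtain ⟨g, hg, h1⟩ := h.2.exists_last (List.cons_ne_nil f l)
    exact ⟨g, List.mem_cons_of_mem _ hg, h1⟩

theorem IsPath.ctgt_le : ∀ {l : List (CEdge N)} {u v : ℝ × ℝ} {e : CEdge N},
    IsPath N u v l → e ∈ l → (ctgt N e).1 ≤ v.1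
  | [e], _, _, f, h, hf => by
    cases List.mem_singleton.1 hf
    exact (congrArg Prod.fst h.2).le
  | g :: f :: l, _, _, e, h, he => by
    rcases List.mem_cons.1 he with rfl | he
    · have h1 := h.2.ctgt_le (List.mem_cons_self (a := f))
      have h2 := csrc_lt_ctgt N f
      rw [h.2.1] at h2
      linarith
    · exact h.2.ctgt_le he

theorem IsPath.csrc_inj : ∀ {l : List (CEdge N)} {u v : ℝ × ℝ} {e f : CEdge N},
    IsPath N u v l → e ∈ l → f ∈ l → csrc N e = csrc N f → e = f
  | g :: l, _, _, e, f, h, he, hf, hef => by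
    have h1 := (IsPath.le_and_nodup N l _ _ h.2).1
    have h2 := csrc_lt_ctgt N g
    rcases List.mem_cons.1 he with rfl | he' <;> rcases List.mem_cons.1 hf with rfl | hf'
    · rfl
    · have := h1 f hf'
      rw [← hef] at this
      linarith
    · have := h1 e he'
      rw [hef] at this
      linarith
    · exact h.2.csrc_inj he' hf' hef

theorem IsPath.ctgt_inj : ∀ {l : List (CEdge N)} {u v : ℝ × ℝ} {e f : CEdge N},
    IsPath N u v l → e ∈ l → f ∈ l → ctgt N e = ctgt N f → e = f
  | g :: l, _, _, e, f, h, he, hf, hef => by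
    have h1 := (IsPath.le_and_nodup N l _ _ h.2).1
    rcases List.mem_cons.1 he with rfl | he' <;> rcases List.mem_cons.1 hf with rfl | hf'
    · rfl
    · have := h1 f hf'
      have h2 := csrc_lt_ctgt N f
      rw [← hef] at h2
      linarith
    · have := h1 e he'
      have h2 := csrc_lt_ctgt N e
      rw [hef] at h2
      linarith
    · exact h.2.ctgt_inj he' hf' hef

open Classical in
/-- The final vertices of the paths formed by a set of edges. -/
noncomputable def ends (A : Finset (CEdge N)) : Finset (ℝ × ℝ) :=
  A.image (ctgt N) \ A.image (csrc N)

theorem mem_ends {A : Finset (CEdge N)} {v : ℝ × ℝ} :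
    v ∈ ends A ↔ (∃ e ∈ A, ctgt N e = v) ∧ ∀ e ∈ A, csrc N e ≠ v := by
  simp only [ends, Finset.mem_sdiff, Finset.mem_image, not_exists, not_and, ne_eq]

theorem csrc_mem_pathVertices {l : List (CEdge N)} {e : CEdge N} (he : e ∈ l) :
    csrc N e ∈ pathVertices N l := ⟨e, he, Or.inl rfl⟩

theorem ctgt_mem_pathVertices {l : List (CEdge N)} {e : CEdge N} (he : e ∈ l) :
    ctgt N e ∈ pathVertices N l := ⟨e, he, Or.inr rfl⟩

/-- A set of edges, with at most one edge entering and at most one edge leaving each vertex, is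
the union of disjoint paths. -/
theorem exists_paths (A : Finset (CEdge N))
    (hs : ∀ e ∈ A, ∀ f ∈ A, csrc N e = csrc N f → e = f)
    (ht : ∀ e ∈ A, ∀ f ∈ A, ctgt N e = ctgt N f → e = f) :
    ∃ path : ℝ × ℝ → List (CEdge N),
      (∀ t ∈ ends A, path t ≠ [] ∧ (∀ e ∈ path t, e ∈ A) ∧
        ∃ u, (∃ e ∈ A, csrc N e = u) ∧ (∀ e ∈ A, ctgt N e ≠ u) ∧ IsPath N u t (path t)) ∧
      (∀ t ∈ ends A, ∀ t' ∈ ends A, t ≠ t' →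
        Disjoint (pathVertices N (path t)) (pathVertices N (path t'))) ∧
      ∀ w : CEdge N → WithBot ℝ, ∑ t ∈ ends A, ((path t).map w).sum = ∑ e ∈ A, w e := by
  classical
  -- The added edge has the rightmost target, so no earlier edge leaves that target: the edge either
  -- prolongs the path ending at its source or forms a new path by itself.
  induction A using Finset.induction_on_max_value (fun e => (ctgt N e).1) with
  | empty => exact ⟨fun _ => [], by simp [ends], by simp [ends], by simp [ends]⟩
  | insert e s hes hmax ih =>
    obtain ⟨path, h1, h2, h3⟩ := ih
      (fun e he f hf => hs e (Finset.mem_insert_of_mem he) f (Finset.mem_insert_of_mem hf))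
      (fun e he f hf => ht e (Finset.mem_insert_of_mem he) f (Finset.mem_insert_of_mem hf))
    have hlt := csrc_lt_ctgt N e
    have hv : ∀ f ∈ s, csrc N f ≠ ctgt N e := fun f hf h => by
      have h4 := hmax f hf
      have h5 := csrc_lt_ctgt N f
      rw [h] at h5
      linarith
    have hv' : ∀ f ∈ s, ctgt N f ≠ ctgt N e := fun f hf h =>
      hes (ht f (Finset.mem_insert_of_mem hf) e (Finset.mem_insert_self _ _) h ▸ hf)
    have hu : ∀ f ∈ s, csrc N f ≠ csrc N e := fun f hf h =>
      hes (hs f (Finset.mem_insert_of_mem hf) e (Finset.mem_insert_self _ _) h ▸ hf)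
    have huv : csrc N e ≠ ctgt N e := fun h => by rw [h] at hlt; exact lt_irrefl _ hlt
    have hvends : ctgt N e ∉ ends s := fun h => by
      obtain ⟨⟨f, hf, h⟩, -⟩ := mem_ends.1 h
      exact hv' f hf h
    have hvpath : ∀ t ∈ ends s, ctgt N e ∉ pathVertices N (path t) := by
      rintro t ht ⟨f, hf, h | h⟩
      · exact hv f ((h1 t ht).2.1 f hf) h.symm
      · exact hv' f ((h1 t ht).2.1 f hf) h.symm
    have hold : ∀ t ∈ ends s, path t ≠ [] ∧ (∀ f ∈ path t, f ∈ insert e s) ∧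
        ∃ u, (∃ e' ∈ insert e s, csrc N e' = u) ∧ (∀ e' ∈ insert e s, ctgt N e' ≠ u) ∧
          IsPath N u t (path t) := by
      intro t ht
      obtain ⟨h4, h5, u, ⟨f, hf, h6⟩, h7, h8⟩ := h1 t ht
      refine ⟨h4, fun f hf => Finset.mem_insert_of_mem (h5 f hf), u,
        ⟨f, Finset.mem_insert_of_mem hf, h6⟩, fun g hg => ?_, h8⟩
      rcases Finset.mem_insert.1 hg with rfl | hg
      · exact fun h => hv f hf (h6.trans h.symm)
      · exact h7 g hg
    by_cases hcase : ∃ f ∈ s, ctgt N f = csrc N e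
    · have huends : csrc N e ∈ ends s := mem_ends.2 ⟨hcase, hu⟩
      have hends : ends (insert e s) = insert (ctgt N e) ((ends s).erase (csrc N e)) := by
        ext t
        simp only [mem_ends, Finset.mem_insert, Finset.mem_erase]
        constructor
        · rintro ⟨⟨f, rfl | hf, rfl⟩, h⟩
          · exact Or.inl rfl
          · exact Or.inr ⟨(h e (Or.inl rfl)).symm, ⟨f, hf, rfl⟩, fun g hg => h g (Or.inr hg)⟩
        · rintro (rfl | ⟨h4, ⟨f, hf, rfl⟩, h5⟩)
          · refine ⟨⟨e, Or.inl rfl, rfl⟩, ?_⟩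
            rintro g (rfl | hg)
            · exact huv
            · exact hv g hg
          · refine ⟨⟨f, Or.inr hf, rfl⟩, ?_⟩
            rintro g (rfl | hg)
            · exact h4.symm
            · exact h5 g hg
      have hne : ∀ t ∈ (ends s).erase (csrc N e), t ≠ ctgt N e := fun t ht h =>
        hvends (h ▸ (Finset.mem_of_mem_erase ht))
      obtain ⟨h4, h5, u, h6, h7, h8⟩ := hold _ huends
      have hnewdisj : ∀ t ∈ (ends s).erase (csrc N e),
          Disjoint (pathVertices N (path (csrc N e) ++ [e])) (pathVertices N (path t)) := by
        intro t ht
        obtain ⟨ht1, ht2⟩ := Finset.mem_erase.1 ht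
        have hd := h2 _ huends t ht2 ht1.symm
        obtain ⟨g, hg, hgu⟩ := h8.exists_last h4
        have hmem := ctgt_mem_pathVertices hg
        rw [hgu] at hmem
        refine Set.disjoint_left.2 ?_
        rintro v ⟨f, hf, hfv⟩ hvt
        rcases List.mem_append.1 hf with hf | hf
        · exact Set.disjoint_left.1 hd ⟨f, hf, hfv⟩ hvt
        · cases List.mem_singleton.1 hf
          rcases hfv with rfl | rfl
          · exact Set.disjoint_left.1 hd hmem hvt
          · exact hvpath t ht2 hvt
      refine ⟨Function.update path (ctgt N e) (path (csrc N e) ++ [e]), ?_, ?_, ?_⟩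
      · intro t ht
        rw [hends] at ht
        rcases Finset.mem_insert.1 ht with rfl | ht
        · rw [Function.update_self]
          refine ⟨by simp, fun f hf => ?_, u, h6, h7, h8.append_singleton rfl⟩
          rcases List.mem_append.1 hf with hf | hf
          · exact h5 f hf
          · cases List.mem_singleton.1 hf
            exact Finset.mem_insert_self _ _
        · rw [Function.update_of_ne (hne t ht)]
          exact hold t (Finset.mem_of_mem_erase ht)
      · intro t ht t' ht' htt'
        rw [hends] at ht ht'
        rcases Finset.mem_insert.1 ht with rfl | ht <;>
          rcases Finset.mem_insert.1 ht' with rfl | ht'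
        · exact absurd rfl htt'
        · rw [Function.update_self, Function.update_of_ne (hne t' ht')]
          exact hnewdisj t' ht'
        · rw [Function.update_self, Function.update_of_ne (hne t ht)]
          exact (hnewdisj t ht).symm
        · rw [Function.update_of_ne (hne t ht), Function.update_of_ne (hne t' ht')]
          exact h2 t (Finset.mem_of_mem_erase ht) t' (Finset.mem_of_mem_erase ht') htt'
      · intro w
        rw [hends, Finset.sum_insert fun h => hne _ h rfl, Function.update_self,
          Finset.sum_congr rfl fun t ht => by rw [Function.update_of_ne (hne t ht)],
          Finset.sum_insert hes, ← h3 w, ← Finset.add_sum_erase _ _ huends]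
        simp only [List.map_append, List.sum_append, List.map_cons, List.map_nil, List.sum_cons,
          List.sum_nil, add_zero]
        abel
    · push Not at hcase
      have hends : ends (insert e s) = insert (ctgt N e) (ends s) := by
        ext t
        simp only [mem_ends, Finset.mem_insert]
        constructor
        · rintro ⟨⟨f, rfl | hf, rfl⟩, h⟩
          · exact Or.inl rfl
          · exact Or.inr ⟨⟨f, hf, rfl⟩, fun g hg => h g (Or.inr hg)⟩
        · rintro (rfl | ⟨⟨f, hf, rfl⟩, h5⟩)
          · refine ⟨⟨e, Or.inl rfl, rfl⟩, ?_⟩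
            rintro g (rfl | hg)
            · exact huv
            · exact hv g hg
          · refine ⟨⟨f, Or.inr hf, rfl⟩, ?_⟩
            rintro g (rfl | hg)
            · exact (hcase f hf).symm
            · exact h5 g hg
      have hne : ∀ t ∈ ends s, t ≠ ctgt N e := fun t ht h => hvends (h ▸ ht)
      have hnewdisj : ∀ t ∈ ends s,
          Disjoint (pathVertices N [e]) (pathVertices N (path t)) := by
        intro t ht
        refine Set.disjoint_left.2 ?_
        rintro v ⟨f, hf, hfv⟩ hvt
        cases List.mem_singleton.1 hf
        rcases hfv with rfl | rfl
        · obtain ⟨g, hg, h | h⟩ := hvt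
          · exact hu g ((h1 t ht).2.1 g hg) h.symm
          · exact hcase g ((h1 t ht).2.1 g hg) h.symm
        · exact hvpath t ht hvt
      refine ⟨Function.update path (ctgt N e) [e], ?_, ?_, ?_⟩
      · intro t ht
        rw [hends] at ht
        rcases Finset.mem_insert.1 ht with rfl | ht
        · rw [Function.update_self]
          refine ⟨by simp, by simp, csrc N e, ⟨e, Finset.mem_insert_self _ _, rfl⟩, ?_, rfl, rfl⟩
          intro g hg
          rcases Finset.mem_insert.1 hg with rfl | hg
          · exact huv.symm
          · exact hcase g hg
        · rw [Function.update_of_ne (hne t ht)]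
          exact hold t ht
      · intro t ht t' ht' htt'
        rw [hends] at ht ht'
        rcases Finset.mem_insert.1 ht with rfl | ht <;>
          rcases Finset.mem_insert.1 ht' with rfl | ht'
        · exact absurd rfl htt'
        · rw [Function.update_self, Function.update_of_ne (hne t' ht')]
          exact hnewdisj t' ht'
        · rw [Function.update_self, Function.update_of_ne (hne t ht)]
          exact (hnewdisj t ht).symm
        · rw [Function.update_of_ne (hne t ht), Function.update_of_ne (hne t' ht')]
          exact h2 t ht t' ht' htt'
      · intro w
        rw [hends, Finset.sum_insert hvends, Function.update_self,
          Finset.sum_congr rfl fun t ht => by rw [Function.update_of_ne (hne t ht)],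
          Finset.sum_insert hes, ← h3 w]
        simp

end PlanarNetwork

/-! ### Gelfand–Zeitlin multipaths as linkages -/

namespace PlanarNetwork

variable {n k : ℕ} {N : Fin k → PlanarNetwork n}

/-- The edges of the concatenation together with an edge without target at each point: their left
endpoint. -/
noncomputable def extSrc (N : Fin k → PlanarNetwork n) : CEdge N ⊕ ℝ × ℝ → ℝ × ℝ :=
  Sum.elim (csrc N) id

/-- The edges of the concatenation together with an edge without target at each point: their right
endpoint. -/
noncomputable def extTgt (N : Fin k → PlanarNetwork n) : CEdge N ⊕ ℝ × ℝ → Option (ℝ × ℝ) :=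
  Sum.elim (fun e => some (ctgt N e)) fun _ => none

@[simp] theorem extSrc_inl (e : CEdge N) : extSrc N (.inl e) = csrc N e := rfl
@[simp] theorem extSrc_inr (v : ℝ × ℝ) : extSrc N (.inr v) = v := rfl
@[simp] theorem extTgt_inl (e : CEdge N) : extTgt N (.inl e) = some (ctgt N e) := rfl
@[simp] theorem extTgt_inr (v : ℝ × ℝ) : extTgt N (.inr v) = none := rfl

/-- The sinks `1, …, α i` on the vertical lines `i + 1`. -/
noncomputable def sinkPts (N : Fin k → PlanarNetwork n) (α : Fin k → ℕ) : Finset (ℝ × ℝ) :=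
  Finset.univ.biUnion fun i => (Finset.Icc 1 (α i)).image fun b : ℕ => (vertical N (i + 1), (b : ℝ))

/-- The `s` highest sources. -/
noncomputable def sourcePts (n s : ℕ) : Finset (ℝ × ℝ) :=
  (Finset.Icc (n - s + 1) n).image fun a : ℕ => ((0 : ℝ), (a : ℝ))

theorem mem_sinkPts {α : Fin k → ℕ} {v : ℝ × ℝ} : v ∈ sinkPts N α ↔
    ∃ i, ∃ b : ℕ, 1 ≤ b ∧ b ≤ α i ∧ v = (vertical N (i + 1), (b : ℝ)) := by
  simp only [sinkPts, Finset.mem_biUnion, Finset.mem_univ, true_and, Finset.mem_image,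
    Finset.mem_Icc]
  constructor
  · rintro ⟨i, b, ⟨h1, h2⟩, rfl⟩
    exact ⟨i, b, h1, h2, rfl⟩
  · rintro ⟨i, b, h1, h2, rfl⟩
    exact ⟨i, b, ⟨h1, h2⟩, rfl⟩

theorem mem_sourcePts {s : ℕ} {v : ℝ × ℝ} : v ∈ sourcePts n s ↔
    ∃ a : ℕ, n - s + 1 ≤ a ∧ a ≤ n ∧ v = (0, (a : ℝ)) := by
  simp only [sourcePts, Finset.mem_image, Finset.mem_Icc]
  constructor
  · rintro ⟨b, ⟨h1, h2⟩, rfl⟩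
    exact ⟨b, h1, h2, rfl⟩
  · rintro ⟨b, h1, h2, rfl⟩
    exact ⟨b, ⟨h1, h2⟩, rfl⟩

theorem mk_mem_sinkPts {α : Fin k → ℕ} {i : Fin k} {b : ℕ} :
    (vertical N (i + 1), (b : ℝ)) ∈ sinkPts N α ↔ 1 ≤ b ∧ b ≤ α i := by
  rw [mem_sinkPts]
  constructor
  · rintro ⟨j, c, h1, h2, h3⟩
    obtain ⟨h3, h4⟩ := Prod.mk.inj h3
    obtain rfl := vertical_succ_injective h3
    obtain rfl := Nat.cast_injective h4
    exact ⟨h1, h2⟩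
  · rintro ⟨h1, h2⟩
    exact ⟨i, b, h1, h2, rfl⟩

theorem sinkPts_pos {α : Fin k → ℕ} {v : ℝ × ℝ} (hv : v ∈ sinkPts N α) : 0 < v.1 := by
  obtain ⟨i, b, -, -, rfl⟩ := mem_sinkPts.1 hv
  exact vertical_succ_pos N i

theorem sourcePts_fst {s : ℕ} {v : ℝ × ℝ} (hv : v ∈ sourcePts n s) : v.1 = 0 := by
  obtain ⟨b, -, -, rfl⟩ := mem_sourcePts.1 hv
  rfl

theorem sourcePts_mono {s t : ℕ} (h : s ≤ t) : sourcePts n s ⊆ sourcePts n t := by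
  intro v hv
  obtain ⟨b, h1, h2, rfl⟩ := mem_sourcePts.1 hv
  exact mem_sourcePts.2 ⟨b, by omega, h2, rfl⟩

theorem card_sourcePts {s : ℕ} (h : s ≤ n) : (sourcePts n s).card = s := by
  rw [sourcePts, Finset.card_image_of_injective, Nat.card_Icc]
  · omega
  · intro a b hab
    exact Nat.cast_injective (Prod.mk.inj hab).2

theorem exists_mem_disjSum {α β : Type*} {A : Finset α} {T : Finset β} {p : α ⊕ β → Prop} :
    (∃ x ∈ A.disjSum T, p x) ↔ (∃ e ∈ A, p (.inl e)) ∨ ∃ t ∈ T, p (.inr t) := by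
  simp only [Sum.exists, Finset.inl_mem_disjSum, Finset.inr_mem_disjSum]

/-- The edges of a multipath with the highest sources and the lowest sinks. -/
def IsGZ (N : Fin k → PlanarNetwork n) (α : Fin k → ℕ) (A : Finset (CEdge N)) : Prop :=
  IsLinkage (extSrc N) (extTgt N) (A.disjSum (sinkPts N α)) (sourcePts n (∑ i, α i))

/-- The axiom that no edge enters a source disappears, as targets have positive abscissa.
Injectivity of the left endpoint, applied to an edge and a formal sink edge, becomes the condition
that no edge leaves a sink. -/
theorem isGZ_iff {α : Fin k → ℕ} {A : Finset (CEdge N)} : IsGZ N α A ↔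
    (∀ e ∈ A, ∀ f ∈ A, csrc N e = csrc N f → e = f) ∧
    (∀ e ∈ A, ∀ f ∈ A, ctgt N e = ctgt N f → e = f) ∧
    (∀ e ∈ A, csrc N e ∉ sinkPts N α) ∧
    ∀ v, ((∃ e ∈ A, csrc N e = v) ∨ v ∈ sinkPts N α) ↔
      (v ∈ sourcePts n (∑ i, α i) ∨ ∃ e ∈ A, ctgt N e = v) := by
  constructor
  · intro h
    refine ⟨fun e he f hf hef => ?_, fun e he f hf hef => ?_, fun e he h' => ?_, fun v => ?_⟩
    · exact Sum.inl_injective (h.src_inj (.inl e) (by simpa using he) (.inl f) (by simpa using hf) hef)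
    · exact Sum.inl_injective (h.tgt_inj (.inl e) (by simpa using he) (.inl f) (by simpa using hf)
        _ rfl (congrArg some hef.symm))
    · have := h.src_inj (.inl e) (by simpa using he) (.inr (csrc N e)) (by simpa using h') rfl
      cases this
    · have := h.balance v
      simpa only [exists_mem_disjSum, extSrc_inl, extSrc_inr, extTgt_inl, extTgt_inr,
        Option.some.injEq, reduceCtorEq, and_false, exists_false, or_false, exists_eq_right]
        using this
  · rintro ⟨h1, h2, h3, h4⟩
    refine ⟨?_, ?_, ?_, fun v => ?_⟩
    · rintro (e | e) he (f | f) hf hef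
      · exact congrArg _ (h1 e (by simpa using he) f (by simpa using hf) hef)
      · have : csrc N e = f := hef
        exact absurd (by simpa [this] using hf) (h3 e (by simpa using he))
      · have : e = csrc N f := hef
        exact absurd (by simpa [← this] using he) (h3 f (by simpa using hf))
      · exact congrArg _ hef
    · rintro (e | e) he (f | f) hf v hev hfv
      · refine congrArg _ (h2 e (by simpa using he) f (by simpa using hf) ?_)
        exact Option.some.inj (hev.trans hfv.symm)
      · cases hfv
      · cases hev
      · cases hfv
    · rintro v hv (e | e) he hev
      · have h5 := ctgt_pos e
        rw [Option.some.inj hev, sourcePts_fst hv] at h5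
        exact lt_irrefl _ h5
      · cases hev
    · have := h4 v
      simpa only [exists_mem_disjSum, extSrc_inl, extSrc_inr, extTgt_inl, extTgt_inr,
        Option.some.injEq, reduceCtorEq, and_false, exists_false, or_false, exists_eq_right]
        using this

theorem sum_sinkPts {M : Type*} [AddCommMonoid M] (α : Fin k → ℕ) (g : ℝ × ℝ → M) :
    ∑ t ∈ sinkPts N α, g t =
      ∑ i : Fin k, ∑ b ∈ Finset.Icc 1 (α i), g (vertical N (i + 1), (b : ℝ)) := by
  unfold sinkPts
  rw [Finset.sum_biUnion]
  · refine Finset.sum_congr rfl fun i _ => Finset.sum_image ?_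
    intro b _ c _ hbc
    exact Nat.cast_injective (Prod.mk.inj hbc).2
  · intro i _ j _ hij
    refine Finset.disjoint_left.2 fun v hv hv' => hij ?_
    obtain ⟨b, -, rfl⟩ := Finset.mem_image.1 hv
    obtain ⟨c, -, hbc⟩ := Finset.mem_image.1 hv'
    exact vertical_succ_injective (Prod.mk.inj hbc).1.symm

theorem source_ne_sink (i : Fin k) (a b : ℕ) :
    ((0 : ℝ), (a : ℝ)) ≠ (vertical N (i + 1), (b : ℝ)) := fun h' =>
  (vertical_succ_pos N i).ne (Prod.mk.inj h').1

/-- In the decomposition given by `exists_paths`, the balance identifies final vertices with the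
sinks and initial vertices with sources. A path ending on line `i + 1` stays in the first `i + 1`
networks because abscissas increase along it. -/
theorem IsGZ.exists_multipath {α : Fin k → ℕ} {A : Finset (CEdge N)} (hn : ∀ i, α i ≤ n)
    (h : IsGZ N α A) (w : ∀ i, (N i).Weighting) :
    ∃ p : Multipath N α, p.weight w = ∑ e ∈ A, w e.1 e.2 := by
  classical
  obtain ⟨h1, h2, h3, h4⟩ := isGZ_iff.1 h
  have hends : ends A = sinkPts N α := by
    ext v
    rw [mem_ends]
    constructor
    · rintro ⟨⟨e, he, rfl⟩, h5⟩
      rcases (h4 _).2 (Or.inr ⟨e, he, rfl⟩) with ⟨f, hf, h6⟩ | h6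
      · exact absurd h6 (h5 f hf)
      · exact h6
    · intro hv
      refine ⟨((h4 v).1 (Or.inr hv)).resolve_left fun h5 => ?_, fun e he h5 => h3 e he (h5 ▸ hv)⟩
      exact (sinkPts_pos hv).ne' (sourcePts_fst h5)
  obtain ⟨path, p1, p2, p3⟩ := exists_paths A h1 h2
  rw [hends] at p1 p2 p3
  have hne : ∀ t ∈ sinkPts N α, ∀ t' ∈ sinkPts N α, path t = path t' → t = t' := by
    intro t ht t' ht' htt
    obtain ⟨q1, -, u, -, -, q3⟩ := p1 t ht
    by_contra hne
    have hd := p2 t ht t' ht' hne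
    obtain ⟨e, he, -⟩ := q3.exists_last q1
    rw [← htt] at hd
    exact Set.disjoint_left.1 hd (csrc_mem_pathVertices he) (csrc_mem_pathVertices he)
  have hmem : ∀ (i : Fin k) (b : ℕ), b ∈ Finset.Icc 1 (α i) →
      (vertical N (i + 1), (b : ℝ)) ∈ sinkPts N α := fun i b hb =>
    mk_mem_sinkPts.2 (Finset.mem_Icc.1 hb)
  have hinj : ∀ i : Fin k, Set.InjOn (fun b : ℕ => path (vertical N (i + 1), (b : ℝ)))
      (Finset.Icc 1 (α i)) := fun i b hb c hc hbc =>
    Nat.cast_injective (Prod.mk.inj (hne _ (hmem i b hb) _ (hmem i c hc) hbc)).2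
  refine ⟨⟨fun i => (Finset.Icc 1 (α i)).image fun b : ℕ => path (vertical N (i + 1), (b : ℝ)),
    fun i => ?_, fun i l hl => ?_, fun i j l hl l' hl' hll => ?_⟩, ?_⟩
  · rw [Finset.card_image_of_injOn (hinj i), Nat.card_Icc]
    omega
  · obtain ⟨b, hb, rfl⟩ := Finset.mem_image.1 hl
    obtain ⟨q1, q2, u, ⟨e, he, q3⟩, q4, q5⟩ := p1 _ (hmem i b hb)
    have hu : u ∈ sourcePts n (∑ i, α i) := by
      rcases (h4 u).1 (Or.inl ⟨e, he, q3⟩) with h5 | ⟨f, hf, h5⟩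
      · exact h5
      · exact absurd h5 (q4 f hf)
    obtain ⟨a, ha1, ha2, rfl⟩ := mem_sourcePts.1 hu
    rw [Finset.mem_Icc] at hb
    refine ⟨a, b, Finset.mem_Icc.2 ⟨by omega, ha2⟩,
      Finset.mem_Icc.2 ⟨hb.1, hb.2.trans (hn i)⟩, fun f hf => ?_, q5⟩
    by_contra! hfi
    have h5 := q5.ctgt_le hf
    have h6 := csrc_lt_ctgt N f
    have h7 := vertical_le_csrc f
    have h8 := vertical_mono N (show i.val + 1 ≤ f.1.val from hfi)
    simp only at h5
    linarith
  · obtain ⟨b, hb, rfl⟩ := Finset.mem_image.1 hl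
    obtain ⟨c, hc, rfl⟩ := Finset.mem_image.1 hl'
    refine p2 _ (hmem i b hb) _ (hmem j c hc) fun h5 => hll ?_
    obtain ⟨h5, h6⟩ := Prod.mk.inj h5
    obtain rfl := vertical_succ_injective h5
    rw [h6]
  · rw [← p3, Multipath.weight, sum_sinkPts]
    exact Finset.sum_congr rfl fun i _ => Finset.sum_image (hinj i)

open Classical in
/-- The edges of a multipath. -/
noncomputable def Multipath.edges {α : Fin k → ℕ} (p : Multipath N α) : Finset (CEdge N) :=
  Finset.univ.biUnion fun i => (p.paths i).biUnion List.toFinset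

theorem Multipath.mem_edges {α : Fin k → ℕ} {p : Multipath N α} {e : CEdge N} :
    e ∈ p.edges ↔ ∃ i, ∃ l ∈ p.paths i, e ∈ l := by
  simp [edges]

theorem Multipath.eq_of_mem_pathVertices {α : Fin k → ℕ} (p : Multipath N α) {i j : Fin k}
    {l l' : List (CEdge N)} (hl : l ∈ p.paths i) (hl' : l' ∈ p.paths j) {v : ℝ × ℝ}
    (hv : v ∈ pathVertices N l) (hv' : v ∈ pathVertices N l') : i = j ∧ l = l' := by
  by_contra h
  refine Set.disjoint_left.1 (p.nonintersecting i j l hl l' hl' fun h' => h ?_) hv hv'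
  exact Prod.mk.inj h'

theorem Multipath.weight_eq {α : Fin k → ℕ} (p : Multipath N α) (w : ∀ i, (N i).Weighting) :
    p.weight w = ∑ e ∈ p.edges, w e.1 e.2 := by
  classical
  have hE : p.edges = Finset.univ.biUnion fun i => (p.paths i).biUnion List.toFinset := by
    ext e; simp [mem_edges]
  rw [hE, Finset.sum_biUnion, Multipath.weight]
  · refine Finset.sum_congr rfl fun i _ => ?_
    rw [Finset.sum_biUnion]
    · refine Finset.sum_congr rfl fun l hl => ?_
      obtain ⟨a, b, -, -, -, h⟩ := p.connects i l hl
      rw [List.sum_toFinset _ (IsPath.le_and_nodup N l _ _ h).2]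
    · intro l hl l' hl' hne
      refine Finset.disjoint_left.2 fun e he he' => hne ?_
      exact (p.eq_of_mem_pathVertices hl hl' (csrc_mem_pathVertices (List.mem_toFinset.1 he))
        (csrc_mem_pathVertices (List.mem_toFinset.1 he'))).2
  · intro i _ j _ hij
    refine Finset.disjoint_left.2 fun e he he' => hij ?_
    obtain ⟨l, hl, he⟩ := Finset.mem_biUnion.1 he
    obtain ⟨l', hl', he'⟩ := Finset.mem_biUnion.1 he'
    exact (p.eq_of_mem_pathVertices hl hl' (csrc_mem_pathVertices (List.mem_toFinset.1 he))
        (csrc_mem_pathVertices (List.mem_toFinset.1 he'))).1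

/-- Disjointness makes a vertex determine its path, and abscissas increase along a path; hence at
most one edge enters or leaves each vertex, and none leaves a sink. -/
theorem Multipath.isGZ {α : Fin k → ℕ} (p : Multipath N α)
    (hsource : p.sources = Set.Icc (n - ∑ i, α i + 1) n)
    (hsink : ∀ i, p.sinks i = Set.Icc 1 (α i)) : IsGZ N α p.edges := by
  have hlast : ∀ v ∈ sinkPts N α, ∃ i, ∃ l ∈ p.paths i, ∃ e ∈ l, ctgt N e = v ∧
      ∃ u, IsPath N u v l := by
    intro v hv
    obtain ⟨i, b, h1, h2, rfl⟩ := mem_sinkPts.1 hv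
    have hb : b ∈ p.sinks i := by rw [hsink]; exact ⟨h1, h2⟩
    obtain ⟨l, hl, a, h⟩ := hb
    obtain ⟨e, he, -⟩ := h.2.2.2.exists_first (source_ne_sink i a b)
    obtain ⟨e, he, h3⟩ := h.2.2.2.exists_last (List.ne_nil_of_mem he)
    exact ⟨i, l, hl, e, he, h3, _, h.2.2.2⟩
  refine isGZ_iff.2 ⟨fun e he f hf hef => ?_, fun e he f hf hef => ?_, fun e he hs => ?_,
    fun v => ⟨?_, ?_⟩⟩
  · obtain ⟨i, l, hl, he⟩ := mem_edges.1 he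
    obtain ⟨j, l', hl', hf⟩ := mem_edges.1 hf
    obtain ⟨rfl, rfl⟩ := p.eq_of_mem_pathVertices hl hl' (csrc_mem_pathVertices he)
      (hef ▸ csrc_mem_pathVertices hf)
    obtain ⟨a, b, -, -, -, h⟩ := p.connects i l hl
    exact h.csrc_inj he hf hef
  · obtain ⟨i, l, hl, he⟩ := mem_edges.1 he
    obtain ⟨j, l', hl', hf⟩ := mem_edges.1 hf
    obtain ⟨rfl, rfl⟩ := p.eq_of_mem_pathVertices hl hl' (ctgt_mem_pathVertices he)
      (hef ▸ ctgt_mem_pathVertices hf)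
    obtain ⟨a, b, -, -, -, h⟩ := p.connects i l hl
    exact h.ctgt_inj he hf hef
  · obtain ⟨i, l, hl, he⟩ := mem_edges.1 he
    obtain ⟨j, l', hl', f, hf, hfe, u, h⟩ := hlast _ hs
    obtain ⟨rfl, rfl⟩ := p.eq_of_mem_pathVertices hl hl' (csrc_mem_pathVertices he)
      (hfe ▸ ctgt_mem_pathVertices hf)
    have h1 := h.ctgt_le he
    have h2 := csrc_lt_ctgt N e
    linarith
  · rintro (⟨e, he, rfl⟩ | hv)
    · obtain ⟨i, l, hl, he⟩ := mem_edges.1 he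
      obtain ⟨a, b, h⟩ := p.connects i l hl
      rcases h.2.2.2.csrc_eq he with h1 | ⟨f, hf, h1⟩
      · have ha : a ∈ p.sources := ⟨i, l, hl, b, h⟩
        rw [hsource] at ha
        exact Or.inl (mem_sourcePts.2 ⟨a, ha.1, ha.2, h1⟩)
      · exact Or.inr ⟨f, mem_edges.2 ⟨i, l, hl, hf⟩, h1⟩
    · obtain ⟨i, l, hl, e, he, h, -⟩ := hlast v hv
      exact Or.inr ⟨e, mem_edges.2 ⟨i, l, hl, he⟩, h⟩
  · rintro (hv | ⟨e, he, rfl⟩)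
    · obtain ⟨a, h1, h2, rfl⟩ := mem_sourcePts.1 hv
      have ha : a ∈ p.sources := by rw [hsource]; exact ⟨h1, h2⟩
      obtain ⟨i, l, hl, b, h⟩ := ha
      obtain ⟨e, he, h3⟩ := h.2.2.2.exists_first (source_ne_sink i a b)
      exact Or.inl ⟨e, mem_edges.2 ⟨i, l, hl, he⟩, h3⟩
    · obtain ⟨i, l, hl, he⟩ := mem_edges.1 he
      obtain ⟨a, b, h⟩ := p.connects i l hl
      rcases h.2.2.2.ctgt_eq he with h1 | ⟨f, hf, h1⟩
      · have hb : b ∈ p.sinks i := ⟨l, hl, a, h⟩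
        rw [hsink] at hb
        exact Or.inr (h1 ▸ mk_mem_sinkPts.2 hb)
      · exact Or.inl ⟨f, mem_edges.2 ⟨i, l, hl, hf⟩, h1⟩

theorem Multipath.weight_le_m {α : Fin k → ℕ} (p : Multipath N α) (w : ∀ i, (N i).Weighting) :
    p.weight w ≤ m N w α := by
  let := Fintype.ofFinite (Multipath N α)
  exact Finset.le_sup (f := fun p : Multipath N α => p.weight w) (Finset.mem_univ p)

/-- The multi-Gelfand–Zeitlin condition is used only through this lemma. With `IsGZ.sum_le_m`, it
reduces inequalities between the numbers `m` to exchanges of edges. -/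
theorem MultiGZ.exists_isGZ {w : ∀ i, (N i).Weighting} (h : MultiGZ N w) {α : Fin k → ℕ}
    (hα : ∑ i, α i ≤ n) : ∃ A, IsGZ N α A ∧ m N w α = ∑ e ∈ A, w e.1 e.2 := by
  obtain ⟨p, h1, h2, h3⟩ := h α hα
  refine ⟨p.edges, p.isGZ h2 h3, ?_⟩
  rw [← p.weight_eq]
  exact le_antisymm (Finset.sup_le fun q _ => h1 q) (p.weight_le_m w)

theorem IsGZ.sum_le_m {α : Fin k → ℕ} (hα : ∑ i, α i ≤ n) {A : Finset (CEdge N)}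
    (h : IsGZ N α A) (w : ∀ i, (N i).Weighting) : ∑ e ∈ A, w e.1 e.2 ≤ m N w α := by
  obtain ⟨p, hp⟩ := h.exists_multipath
    (fun i => (Finset.single_le_sum (fun _ _ => Nat.zero_le _) (Finset.mem_univ i)).trans hα) w
  exact hp ▸ p.weight_le_m w

end PlanarNetwork

/-! ### Planarity: the number of edges above a given edge is constant along it -/

namespace PlanarNetwork

open Filter Topology

variable {n k : ℕ} {N : Fin k → PlanarNetwork n}

/-! ### The drawing of the concatenation -/

/-- The height of an edge of the concatenation above a point of the horizontal axis. -/
noncomputable def height (e : CEdge N) (x : ℝ) : ℝ :=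
  (N e.1).curve e.2 (x - vertical N e.1)

theorem height_csrc (e : CEdge N) : height e (csrc N e).1 = (csrc N e).2 := by
  simp only [height, csrc, add_sub_cancel_left]
  exact (N e.1).curve_src e.2

theorem height_ctgt (e : CEdge N) : height e (ctgt N e).1 = (ctgt N e).2 := by
  simp only [height, ctgt, add_sub_cancel_left]
  exact (N e.1).curve_tgt e.2

theorem continuousOn_height (e : CEdge N) :
    ContinuousOn (height e) (Set.Icc (csrc N e).1 (ctgt N e).1) := by
  refine ((N e.1).curve_continuous e.2).comp (by fun_prop) fun x hx => ?_
  simp only [csrc, ctgt, Set.mem_Icc] at hx ⊢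
  constructor <;> linarith

/-- The networks occupy consecutive strips. Used in both directions, this puts edges with
overlapping abscissas in the same network, where the planarity axioms apply. -/
theorem edge_index_le {e f : CEdge N} (h : (csrc N e).1 < (ctgt N f).1) : e.1 ≤ f.1 := by
  by_contra! h'
  have h1 := vertical_mono N (show f.1.val + 1 ≤ e.1.val from h')
  have h2 := vertical_le_csrc e
  have h3 := ctgt_le_vertical f
  linarith

theorem height_ne {e f : CEdge N} (hef : e ≠ f) {x : ℝ}
    (he : x ∈ Set.Ioo (csrc N e).1 (ctgt N e).1) (hf : x ∈ Set.Ioo (csrc N f).1 (ctgt N f).1) :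
    height e x ≠ height f x := by
  have h := le_antisymm (edge_index_le (he.1.trans hf.2)) (edge_index_le (hf.1.trans he.2))
  obtain ⟨i, e⟩ := e
  obtain ⟨j, f⟩ := f
  obtain rfl : i = j := h
  refine (N i).edges_disjoint e f (fun h => hef (h ▸ rfl)) _ ?_ ?_
  · simp only [csrc, ctgt, Set.mem_Ioo] at he ⊢
    constructor <;> linarith
  · simp only [csrc, ctgt, Set.mem_Ioo] at hf ⊢
    constructor <;> linarith

theorem height_ne_csrc {e f : CEdge N}
    (he : (csrc N f).1 ∈ Set.Ioo (csrc N e).1 (ctgt N e).1) :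
    height e (csrc N f).1 ≠ (csrc N f).2 := by
  have h := le_antisymm (edge_index_le (he.1.trans (csrc_lt_ctgt N f))) (edge_index_le he.2)
  obtain ⟨i, e⟩ := e
  obtain ⟨j, f⟩ := f
  obtain rfl : i = j := h
  simp only [csrc, ctgt, Set.mem_Ioo, height, add_sub_cancel_left] at he ⊢
  exact (N i).edge_avoids_vertices e _ ((N i).src_mem f) ⟨by linarith, by linarith⟩

theorem height_ne_ctgt {e f : CEdge N}
    (he : (ctgt N f).1 ∈ Set.Ioo (csrc N e).1 (ctgt N e).1) :
    height e (ctgt N f).1 ≠ (ctgt N f).2 := by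
  have h := le_antisymm (edge_index_le he.1) (edge_index_le ((csrc_lt_ctgt N f).trans he.2))
  obtain ⟨i, e⟩ := e
  obtain ⟨j, f⟩ := f
  obtain rfl : i = j := h
  simp only [csrc, ctgt, Set.mem_Ioo, height, add_sub_cancel_left] at he ⊢
  exact (N i).edge_avoids_vertices e _ ((N i).tgt_mem f) ⟨by linarith, by linarith⟩

/-- An edge lies in a single strip, so it cannot cross a vertical line; if it continues to the right
of one, it starts there, at a labelled source of its network. -/
theorem csrc_eq_vertical {e : CEdge N} {j : ℕ} (h1 : (csrc N e).1 ≤ vertical N j)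
    (h2 : vertical N j < (ctgt N e).1) :
    (csrc N e).1 = vertical N j ∧ ∃ h : ℕ, 1 ≤ h ∧ (csrc N e).2 = h := by
  have h3 := ctgt_le_vertical e
  have h4 := vertical_le_csrc e
  have hj : e.1.val = j := by
    rcases lt_trichotomy e.1.val j with h | h | h
    · have := vertical_mono N (Nat.succ_le_of_lt h)
      simp only [Nat.succ_eq_add_one] at this
      linarith
    · exact h
    · have := vertical_lt N ⟨j, h.trans e.1.2⟩ h
      simp only at this
      linarith
  have h5 : (csrc N e).1 = vertical N j := le_antisymm h1 (hj ▸ h4)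
  refine ⟨h5, ?_⟩
  have h6 : ((N e.1).src e.2).1 = 0 := by
    simp only [csrc] at h5
    rw [hj] at h5
    linarith
  obtain ⟨h, hh, h7⟩ := ((N e.1).left_border ((N e.1).src e.2).2).1 (by
    have := (N e.1).src_mem e.2
    rwa [← h6])
  exact ⟨h, (Finset.mem_Icc.1 hh).1, h7⟩

/-- The sinks are the lowest labelled points of their line, so a labelled point that is not a sink
is above them all. -/
theorem sinkPts_le_csrc {α : Fin k → ℕ} {e : CEdge N} (he : csrc N e ∉ sinkPts N α)
    {t : ℝ × ℝ} (ht : t ∈ sinkPts N α) (h : t.1 = (csrc N e).1) : t.2 ≤ (csrc N e).2 := by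
  obtain ⟨q, b, hb1, hb2, rfl⟩ := mem_sinkPts.1 ht
  obtain ⟨h1, a, ha, h2⟩ := csrc_eq_vertical (j := q + 1) h.ge
    (lt_of_eq_of_lt h (csrc_lt_ctgt N e))
  by_contra! h3
  refine he (mem_sinkPts.2 ⟨q, a, ha, ?_, Prod.ext h.symm h2⟩)
  simp only [h2, Nat.cast_lt] at h3
  omega

/-! ### Counting the edges above a point -/

open Classical in
/-- The number of edges of `A` passing above `(x, y)`, just on the left of this point. -/
noncomputable def aboveL (A : Finset (CEdge N)) (x y : ℝ) : ℕ :=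
  (A.filter fun f => ((csrc N f).1 < x ∧ x ≤ (ctgt N f).1) ∧ y < height f x).card

open Classical in
/-- The number of edges of `A` passing above `(x, y)`, just on the right of this point. -/
noncomputable def aboveR (A : Finset (CEdge N)) (x y : ℝ) : ℕ :=
  (A.filter fun f => ((csrc N f).1 ≤ x ∧ x < (ctgt N f).1) ∧ y < height f x).card

theorem IsGZ.card_filter {α : Fin k → ℕ} {A : Finset (CEdge N)} (h : IsGZ N α A)
    (p : ℝ × ℝ → Prop) [DecidablePred p] :
    (A.filter fun e => p (csrc N e)).card + ((sinkPts N α).filter p).card =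
      ((sourcePts n (∑ i, α i)).filter p).card + (A.filter fun e => p (ctgt N e)).card := by
  have h1 := IsLinkage.card_filter_src h p
  simp only [Finset.card_filter, Finset.sum_disjSum, extSrc_inl, extSrc_inr, extTgt_inl,
    extTgt_inr, Option.some.injEq, exists_eq_left', reduceCtorEq, false_and, exists_false,
    if_false, Finset.sum_const_zero, add_zero] at h1 ⊢
  convert h1 <;> split_ifs <;> simp_all

/-- Edges change only at the vertices of the line of abscissa `x`. Those above height `y` are
neither sources, since `0 < x`, nor sinks, by `hsink`, so as many edges enter as leave them. -/
theorem IsGZ.aboveL_eq_aboveR {α : Fin k → ℕ} {A : Finset (CEdge N)} (h : IsGZ N α A)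
    {x y : ℝ} (hx : 0 < x) (hsink : ∀ t ∈ sinkPts N α, t.1 = x → t.2 ≤ y) :
    aboveL A x y = aboveR A x y := by
  classical
  have h1 := h.card_filter fun v => v.1 = x ∧ y < v.2
  have hT : ((sinkPts N α).filter fun v => v.1 = x ∧ y < v.2).card = 0 :=
    Finset.card_eq_zero.2 (Finset.filter_eq_empty_iff.2 fun t ht h' =>
      absurd (hsink t ht h'.1) (not_le.2 h'.2))
  have hU : ((sourcePts n (∑ i, α i)).filter fun v => v.1 = x ∧ y < v.2).card = 0 :=
    Finset.card_eq_zero.2 (Finset.filter_eq_empty_iff.2 fun t ht h' =>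
      hx.ne' (h'.1.symm.trans (sourcePts_fst ht)))
  have h2 : aboveL A x y = (A.filter fun f =>
      ((csrc N f).1 < x ∧ x < (ctgt N f).1) ∧ y < height f x).card +
      (A.filter fun f => (ctgt N f).1 = x ∧ y < (ctgt N f).2).card := by
    rw [aboveL, ← Finset.card_union_of_disjoint]
    · congr 1
      ext f
      simp only [Finset.mem_filter, Finset.mem_union]
      constructor
      · rintro ⟨hf, ⟨h3, h4⟩, h5⟩
        rcases h4.lt_or_eq with h4 | rfl
        · exact Or.inl ⟨hf, ⟨h3, h4⟩, h5⟩
        · exact Or.inr ⟨hf, rfl, height_ctgt f ▸ h5⟩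
      · rintro (⟨hf, ⟨h3, h4⟩, h5⟩ | ⟨hf, rfl, h5⟩)
        · exact ⟨hf, ⟨h3, h4.le⟩, h5⟩
        · exact ⟨hf, ⟨csrc_lt_ctgt N f, le_rfl⟩, (height_ctgt f).symm ▸ h5⟩
    · refine Finset.disjoint_left.2 fun f hf hf' => ?_
      exact (Finset.mem_filter.1 hf).2.1.2.ne' (Finset.mem_filter.1 hf').2.1
  have h3 : aboveR A x y = (A.filter fun f =>
      ((csrc N f).1 < x ∧ x < (ctgt N f).1) ∧ y < height f x).card +
      (A.filter fun f => (csrc N f).1 = x ∧ y < (csrc N f).2).card := by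
    rw [aboveR, ← Finset.card_union_of_disjoint]
    · congr 1
      ext f
      simp only [Finset.mem_filter, Finset.mem_union]
      constructor
      · rintro ⟨hf, ⟨h3, h4⟩, h5⟩
        rcases h3.lt_or_eq with h3 | rfl
        · exact Or.inl ⟨hf, ⟨h3, h4⟩, h5⟩
        · exact Or.inr ⟨hf, rfl, height_csrc f ▸ h5⟩
      · rintro (⟨hf, ⟨h3, h4⟩, h5⟩ | ⟨hf, rfl, h5⟩)
        · exact ⟨hf, ⟨h3.le, h4⟩, h5⟩
        · exact ⟨hf, ⟨le_rfl, csrc_lt_ctgt N f⟩, (height_csrc f).symm ▸ h5⟩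
    · refine Finset.disjoint_left.2 fun f hf hf' => ?_
      exact (Finset.mem_filter.1 hf).2.1.1.ne (Finset.mem_filter.1 hf').2.1
  omega

/-- Just on the left of a point of the edge `e`, the edges above `e` are those that pass above
that point and some of those that pass through it. -/
theorem eventually_left_iff {e : CEdge N} {x₀ : ℝ}
    (h₀ : x₀ ∈ Set.Ioc (csrc N e).1 (ctgt N e).1) :
    ∀ᶠ x in 𝓝[<] x₀, ∀ f : CEdge N,
      (((csrc N f).1 < x ∧ x ≤ (ctgt N f).1) ∧ height e x < height f x) ↔
      (((csrc N f).1 < x₀ ∧ x₀ ≤ (ctgt N f).1) ∧ (height e x₀ < height f x₀ ∨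
        (height f x₀ = height e x₀ ∧ height e x < height f x))) := by
  have hcont : ∀ g : CEdge N, (csrc N g).1 < x₀ → x₀ ≤ (ctgt N g).1 →
      Tendsto (height g) (𝓝[<] x₀) (𝓝 (height g x₀)) := by
    intro g h1 h2
    refine ((continuousOn_height g) x₀ ⟨h1.le, h2⟩).mono_left ?_
    refine nhdsWithin_le_iff.2 ?_
    filter_upwards [Ioo_mem_nhdsLT h1] with x hx
    exact ⟨hx.1.le, hx.2.le.trans h2⟩
  refine eventually_all.2 fun f => ?_
  by_cases h1 : (csrc N f).1 < x₀
  · by_cases h2 : x₀ ≤ (ctgt N f).1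
    · have hf := hcont f h1 h2
      have he := hcont e h₀.1 h₀.2
      rcases lt_trichotomy (height e x₀) (height f x₀) with h3 | h3 | h3
      · filter_upwards [he.eventually_lt hf h3, Ioo_mem_nhdsLT h1] with x hx hx'
        simp only [hx, hx'.1, hx'.2.le.trans h2, h1, h2, h3, true_or, and_self]
      · filter_upwards [Ioo_mem_nhdsLT h1] with x hx'
        simp only [hx'.1, hx'.2.le.trans h2, h1, h2, h3, true_and, lt_self_iff_false, false_or]
      · filter_upwards [hf.eventually_lt he h3, Ioo_mem_nhdsLT h1] with x hx hx'
        exact iff_of_false (fun h => hx.not_gt h.2) fun h =>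
          h.2.elim h3.not_gt fun h => h3.ne h.1
    · filter_upwards [Ioo_mem_nhdsLT (not_le.1 h2)] with x hx
      simp only [h2, not_le.2 hx.1, and_false, false_and]
  · filter_upwards [self_mem_nhdsWithin] with x hx
    exact iff_of_false (fun h => h1 (h.1.1.trans hx)) fun h => h1 h.1.1

/-- Just on the right of a point of the edge `e`, the edges above `e` are those that pass above
that point and some of those that pass through it. -/
theorem eventually_right_iff {e : CEdge N} {x₀ : ℝ}
    (h₀ : x₀ ∈ Set.Ico (csrc N e).1 (ctgt N e).1) :
    ∀ᶠ x in 𝓝[>] x₀, ∀ f : CEdge N,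
      (((csrc N f).1 < x ∧ x ≤ (ctgt N f).1) ∧ height e x < height f x) ↔
      (((csrc N f).1 ≤ x₀ ∧ x₀ < (ctgt N f).1) ∧ (height e x₀ < height f x₀ ∨
        (height f x₀ = height e x₀ ∧ height e x < height f x))) := by
  have hcont : ∀ g : CEdge N, (csrc N g).1 ≤ x₀ → x₀ < (ctgt N g).1 →
      Tendsto (height g) (𝓝[>] x₀) (𝓝 (height g x₀)) := by
    intro g h1 h2
    refine ((continuousOn_height g) x₀ ⟨h1, h2.le⟩).mono_left ?_
    refine nhdsWithin_le_iff.2 ?_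
    filter_upwards [Ioo_mem_nhdsGT h2] with x hx
    exact ⟨h1.trans hx.1.le, hx.2.le⟩
  refine eventually_all.2 fun f => ?_
  by_cases h2 : x₀ < (ctgt N f).1
  · by_cases h1 : (csrc N f).1 ≤ x₀
    · have hf := hcont f h1 h2
      have he := hcont e h₀.1 h₀.2
      rcases lt_trichotomy (height e x₀) (height f x₀) with h3 | h3 | h3
      · filter_upwards [he.eventually_lt hf h3, Ioo_mem_nhdsGT h2] with x hx hx'
        simp only [hx, h1.trans_lt hx'.1, hx'.2.le, h1, h2, h3, true_or, and_self]
      · filter_upwards [Ioo_mem_nhdsGT h2] with x hx'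
        simp only [h1.trans_lt hx'.1, hx'.2.le, h1, h2, h3, true_and, lt_self_iff_false, false_or]
      · filter_upwards [hf.eventually_lt he h3] with x hx
        exact iff_of_false (fun h => hx.not_gt h.2) fun h =>
          h.2.elim h3.not_gt fun h => h3.ne h.1
    · filter_upwards [Ioo_mem_nhdsGT (not_le.1 h1)] with x hx
      simp only [h1, hx.2.not_gt, false_and]
  · filter_upwards [self_mem_nhdsWithin] with x hx
    exact iff_of_false (fun h => h2 (lt_of_lt_of_le hx h.1.2)) fun h => h2 h.1.2

-- Besides the edges above the right endpoint of `e`, only those ending at that endpoint can be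
-- above `e` nearby: by planarity no edge has a vertex in its interior.
open Classical in
theorem eventually_aboveL_left (A : Finset (CEdge N)) (e : CEdge N) :
    ∀ᶠ x in 𝓝[<] (ctgt N e).1, aboveL A x (height e x) =
      aboveL A (ctgt N e).1 (ctgt N e).2 +
        (A.filter fun f => ctgt N f = ctgt N e ∧ height e x < height f x).card := by
  filter_upwards [eventually_left_iff (e := e) ⟨csrc_lt_ctgt N e, le_rfl⟩] with x hx
  rw [aboveL, aboveL, ← Finset.card_union_of_disjoint]
  · congr 1
    ext f
    simp only [Finset.mem_filter, Finset.mem_union, hx f, height_ctgt]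
    constructor
    · rintro ⟨hf, h1, h2 | ⟨h2, h3⟩⟩
      · exact Or.inl ⟨hf, h1, h2⟩
      · rcases h1.2.lt_or_eq with h4 | h4
        · exact absurd h2 (height_ne_ctgt ⟨h1.1, h4⟩)
        · exact Or.inr ⟨hf, Prod.ext h4.symm (by rw [← h2, h4, height_ctgt]), h3⟩
    · rintro (⟨hf, h1, h2⟩ | ⟨hf, h1, h2⟩)
      · exact ⟨hf, h1, Or.inl h2⟩
      · rw [← h1, height_ctgt]
        exact ⟨hf, ⟨csrc_lt_ctgt N f, le_rfl⟩, Or.inr ⟨rfl, h2⟩⟩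
  · refine Finset.disjoint_left.2 fun f hf hf' => ?_
    have h1 := (Finset.mem_filter.1 hf).2.2
    have h2 := (Finset.mem_filter.1 hf').2.1
    rw [← h2, height_ctgt] at h1
    exact lt_irrefl _ h1

open Classical in
theorem eventually_aboveL_right (A : Finset (CEdge N)) (e : CEdge N) :
    ∀ᶠ x in 𝓝[>] (csrc N e).1, aboveL A x (height e x) =
      aboveR A (csrc N e).1 (csrc N e).2 +
        (A.filter fun f => csrc N f = csrc N e ∧ height e x < height f x).card := by
  filter_upwards [eventually_right_iff (e := e) ⟨le_rfl, csrc_lt_ctgt N e⟩] with x hx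
  rw [aboveL, aboveR, ← Finset.card_union_of_disjoint]
  · congr 1
    ext f
    simp only [Finset.mem_filter, Finset.mem_union, hx f, height_csrc]
    constructor
    · rintro ⟨hf, h1, h2 | ⟨h2, h3⟩⟩
      · exact Or.inl ⟨hf, h1, h2⟩
      · rcases h1.1.lt_or_eq with h4 | h4
        · exact absurd h2 (height_ne_csrc ⟨h4, h1.2⟩)
        · exact Or.inr ⟨hf, Prod.ext h4 (by rw [← h2, ← h4, height_csrc]), h3⟩
    · rintro (⟨hf, h1, h2⟩ | ⟨hf, h1, h2⟩)
      · exact ⟨hf, h1, Or.inl h2⟩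
      · rw [← h1, height_csrc]
        exact ⟨hf, ⟨le_rfl, csrc_lt_ctgt N f⟩, Or.inr ⟨rfl, h2⟩⟩
  · refine Finset.disjoint_left.2 fun f hf hf' => ?_
    have h1 := (Finset.mem_filter.1 hf).2.2
    have h2 := (Finset.mem_filter.1 hf').2.1
    rw [← h2, height_csrc] at h1
    exact lt_irrefl _ h1

theorem vertical_notMem_Ioo (e : CEdge N) (j : ℕ) :
    vertical N j ∉ Set.Ioo (csrc N e).1 (ctgt N e).1 := fun h =>
  h.1.ne (csrc_eq_vertical h.1.le h.2).1

/-- The number of edges above `e` does not change along `e`. -/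
theorem IsGZ.aboveL_eq {α : Fin k → ℕ} {A : Finset (CEdge N)} (h : IsGZ N α A) (e : CEdge N)
    {x y : ℝ} (hx : x ∈ Set.Ioo (csrc N e).1 (ctgt N e).1)
    (hy : y ∈ Set.Ioo (csrc N e).1 (ctgt N e).1) :
    aboveL A x (height e x) = aboveL A y (height e y) := by
  -- An integer-valued function that is locally constant on an interval is constant.
  refine isPreconnected_Ioo.constant (f := fun x => aboveL A x (height e x))
    (fun x₀ hx₀ => ContinuousAt.continuousWithinAt ?_) hx hy
  have heq : ∀ f : CEdge N, (csrc N f).1 < x₀ ∧ x₀ < (ctgt N f).1 →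
      height f x₀ = height e x₀ → f = e := fun f hf hfe => by
    by_contra hne
    exact height_ne hne hf hx₀ hfe
  have hL : ∀ᶠ x in 𝓝[<] x₀, aboveL A x (height e x) = aboveL A x₀ (height e x₀) := by
    filter_upwards [eventually_left_iff (e := e) ⟨hx₀.1, hx₀.2.le⟩] with x hx
    rw [aboveL, aboveL]
    congr 1
    ext f
    simp only [Finset.mem_filter, hx f]
    constructor
    · rintro ⟨hf, h1, h2 | ⟨h2, h3⟩⟩
      · exact ⟨hf, h1, h2⟩
      · rcases h1.2.lt_or_eq with h4 | rfl
        · exact absurd h3 (heq f ⟨h1.1, h4⟩ h2 ▸ lt_irrefl _)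
        · rw [height_ctgt] at h2
          exact absurd h2.symm (height_ne_ctgt hx₀)
    · exact fun ⟨hf, h1, h2⟩ => ⟨hf, h1, Or.inl h2⟩
  have hR : ∀ᶠ x in 𝓝[>] x₀, aboveL A x (height e x) = aboveL A x₀ (height e x₀) := by
    -- Crossing `x₀` is harmless: interior abscissas of an edge avoid the vertical lines, hence the
    -- sources and the sinks.
    rw [h.aboveL_eq_aboveR ((csrc_nonneg e).trans_lt hx₀.1)]
    · filter_upwards [eventually_right_iff (e := e) ⟨hx₀.1.le, hx₀.2⟩] with x hx
      rw [aboveL, aboveR]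
      congr 1
      ext f
      simp only [Finset.mem_filter, hx f]
      constructor
      · rintro ⟨hf, h1, h2 | ⟨h2, h3⟩⟩
        · exact ⟨hf, h1, h2⟩
        · rcases h1.1.lt_or_eq with h4 | rfl
          · exact absurd h3 (heq f ⟨h4, h1.2⟩ h2 ▸ lt_irrefl _)
          · rw [height_csrc] at h2
            exact absurd h2.symm (height_ne_csrc hx₀)
      · exact fun ⟨hf, h1, h2⟩ => ⟨hf, h1, Or.inl h2⟩
    · intro t ht htx
      obtain ⟨q, b, -, -, rfl⟩ := mem_sinkPts.1 ht
      obtain rfl : vertical N (q + 1) = x₀ := htx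
      exact absurd hx₀ (vertical_notMem_Ioo e (q + 1))
  have : ∀ᶠ x in 𝓝 x₀, aboveL A x (height e x) = aboveL A x₀ (height e x₀) := by
    rw [← nhdsNE_sup_pure, ← nhdsLT_sup_nhdsGT]
    exact eventually_sup.2 ⟨eventually_sup.2 ⟨hL, hR⟩, by simp⟩
  exact (continuousAt_const (y := aboveL A x₀ (height e x₀))).congr (this.mono fun _ h => h.symm)

end PlanarNetwork

/-! ### Levels of edges, and the exchange of all edges of one level -/

namespace PlanarNetwork

open Filter Topology

variable {n k : ℕ} {N : Fin k → PlanarNetwork n}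

/-! ### The level of an edge -/

open Classical in
/-- The number of edges of `B` above a point of `e` minus the number of edges of `R` above it,
where `e` is above its own points if it is in `B`. -/
noncomputable def levelAt (R B : Finset (CEdge N)) (e : CEdge N) (x : ℝ) : ℤ :=
  (aboveL B x (height e x) : ℤ) - aboveL R x (height e x) + if e ∈ B then 1 else 0

/-- The constant value of `levelAt` along an edge. -/
noncomputable def level (R B : Finset (CEdge N)) (e : CEdge N) : ℤ :=
  levelAt R B e (((csrc N e).1 + (ctgt N e).1) / 2)

theorem level_eq_levelAt {α β : Fin k → ℕ} {R B : Finset (CEdge N)} (hR : IsGZ N α R)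
    (hB : IsGZ N β B) {e : CEdge N} {x : ℝ} (hx : x ∈ Set.Ioo (csrc N e).1 (ctgt N e).1) :
    level R B e = levelAt R B e x := by
  have h1 := csrc_lt_ctgt N e
  have h2 : ((csrc N e).1 + (ctgt N e).1) / 2 ∈ Set.Ioo (csrc N e).1 (ctgt N e).1 :=
    ⟨by linarith, by linarith⟩
  rw [level, levelAt, levelAt, hR.aboveL_eq e h2 hx, hB.aboveL_eq e h2 hx]

/-- The number of edges of `B` passing above `v` on its left, minus the same number for `R`. -/
noncomputable def diffL (R B : Finset (CEdge N)) (v : ℝ × ℝ) : ℤ :=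
  (aboveL B v.1 v.2 : ℤ) - aboveL R v.1 v.2

/-- The number of edges of `B` passing above `v` on its right, minus the same number for `R`. -/
noncomputable def diffR (R B : Finset (CEdge N)) (v : ℝ × ℝ) : ℤ :=
  (aboveR B v.1 v.2 : ℤ) - aboveR R v.1 v.2

theorem card_filter_of_unique {ι κ : Type*} [DecidableEq κ] {A : Finset ι} {s : ι → κ} {v : κ}
    (h : ∀ e ∈ A, ∀ f ∈ A, s e = s f → e = f) {g : ι} (hg : g ∈ A) (hgv : s g = v)
    (p : ι → Prop) [DecidablePred p] :
    (A.filter fun f => s f = v ∧ p f).card = if p g then 1 else 0 := by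
  split_ifs with hp
  · refine Finset.card_eq_one.2 ⟨g, ?_⟩
    ext f
    simp only [Finset.mem_filter, Finset.mem_singleton]
    exact ⟨fun hf => h f hf.1 g hg (hf.2.1.trans hgv.symm), fun hf => hf ▸ ⟨hg, hgv, hp⟩⟩
  · refine Finset.card_eq_zero.2 (Finset.filter_eq_empty_iff.2 fun f hf hf' => hp ?_)
    exact h f hf g hg (hf'.1.trans hgv.symm) ▸ hf'.2

open Classical in
/-- The levels of the edges with a common endpoint `v`. -/
theorem level_of_eventually {R B : Finset (CEdge N)} {s : CEdge N → ℝ × ℝ} {F : Filter ℝ}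
    [F.NeBot] {v : ℝ × ℝ} {D : ℤ}
    (hform : ∀ e, s e = v → ∀ᶠ x in F, level R B e = D +
      (B.filter fun f => s f = v ∧ height e x < height f x).card -
      (R.filter fun f => s f = v ∧ height e x < height f x).card + if e ∈ B then 1 else 0)
    (hne : ∀ e f, e ≠ f → s e = v → s f = v → ∀ᶠ x in F, height e x ≠ height f x)
    (hR : ∀ e ∈ R, ∀ f ∈ R, s e = s f → e = f) (hB : ∀ e ∈ B, ∀ f ∈ B, s e = s f → e = f) :
    (∀ r ∈ R, ∀ b ∈ B, s r = v → s b = v → level R B r = level R B b) ∧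
    (∀ r ∈ R, s r = v → (∀ b ∈ B, s b ≠ v) → level R B r = D) ∧
    (∀ b ∈ B, s b = v → (∀ r ∈ R, s r ≠ v) → level R B b = D + 1) := by
  have hnone : ∀ A : Finset (CEdge N), (∀ f ∈ A, s f ≠ v) → ∀ p : CEdge N → Prop,
      (A.filter fun f => s f = v ∧ p f).card = 0 := fun A hA p =>
    Finset.card_eq_zero.2 (Finset.filter_eq_empty_iff.2 fun f hf h => hA f hf h.1)
  refine ⟨fun r hr b hb hrv hbv => ?_, fun r hr hrv hv => ?_, fun b hb hbv hv => ?_⟩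
  · rcases eq_or_ne r b with rfl | hrb
    · rfl
    have hrB : r ∉ B := fun h => hrb (hB r h b hb (hrv.trans hbv.symm))
    obtain ⟨x, h1, h2, h3⟩ := ((hform r hrv).and ((hform b hbv).and (hne r b hrb hrv hbv))).exists
    rw [card_filter_of_unique hB hb hbv, card_filter_of_unique hR hr hrv] at h1 h2
    rw [h1, h2]
    -- Both levels are `D + 1` when `r` runs below `b` near `v`, and `D` when it runs above. The
    -- summand `1` for edges of `B` in `levelAt` is what makes them agree.
    rcases lt_or_gt_of_ne h3 with h | h
    · simp [h, h.not_gt, hrB, hb]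
    · simp [h, h.not_gt, hrB, hb]
  · obtain ⟨x, h1⟩ := (hform r hrv).exists
    rw [hnone B hv, card_filter_of_unique hR hr hrv, if_neg (lt_irrefl _),
      if_neg fun h => hv r h hrv] at h1
    simpa using h1
  · obtain ⟨x, h1⟩ := (hform b hbv).exists
    rw [hnone R hv, card_filter_of_unique hB hb hbv, if_neg (lt_irrefl _), if_pos hb] at h1
    simpa using h1

section Vertex

variable {α β : Fin k → ℕ} {R B : Finset (CEdge N)}

/-- When only one family enters `v`, the level is read off from the counts above `v` alone. With
`level_of_csrc` and `diffL_eq_diffR`, this carries a level across a vertex that the other family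
avoids. -/
theorem level_of_ctgt (hR : IsGZ N α R) (hB : IsGZ N β B) (v : ℝ × ℝ) :
    (∀ r ∈ R, ∀ b ∈ B, ctgt N r = v → ctgt N b = v → level R B r = level R B b) ∧
    (∀ r ∈ R, ctgt N r = v → (∀ b ∈ B, ctgt N b ≠ v) → level R B r = diffL R B v) ∧
    (∀ b ∈ B, ctgt N b = v → (∀ r ∈ R, ctgt N r ≠ v) → level R B b = diffL R B v + 1) := by
  refine level_of_eventually (F := 𝓝[<] v.1) ?_ ?_ (isGZ_iff.1 hR).2.1 (isGZ_iff.1 hB).2.1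
  · rintro e rfl
    filter_upwards [eventually_aboveL_left R e, eventually_aboveL_left B e,
      Ioo_mem_nhdsLT (csrc_lt_ctgt N e)] with x h1 h2 h3
    rw [level_eq_levelAt hR hB h3, levelAt, h1, h2, diffL]
    push_cast
    ring
  · rintro e f hef rfl hf
    filter_upwards [Ioo_mem_nhdsLT (csrc_lt_ctgt N e),
      hf ▸ Ioo_mem_nhdsLT (csrc_lt_ctgt N f)] with x h1 h2
    exact height_ne hef h1 (by rwa [hf])

theorem level_of_csrc (hR : IsGZ N α R) (hB : IsGZ N β B) (v : ℝ × ℝ) :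
    (∀ r ∈ R, ∀ b ∈ B, csrc N r = v → csrc N b = v → level R B r = level R B b) ∧
    (∀ r ∈ R, csrc N r = v → (∀ b ∈ B, csrc N b ≠ v) → level R B r = diffR R B v) ∧
    (∀ b ∈ B, csrc N b = v → (∀ r ∈ R, csrc N r ≠ v) → level R B b = diffR R B v + 1) := by
  refine level_of_eventually (F := 𝓝[>] v.1) ?_ ?_ (isGZ_iff.1 hR).1 (isGZ_iff.1 hB).1
  · rintro e rfl
    filter_upwards [eventually_aboveL_right R e, eventually_aboveL_right B e,
      Ioo_mem_nhdsGT (csrc_lt_ctgt N e)] with x h1 h2 h3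
    rw [level_eq_levelAt hR hB h3, levelAt, h1, h2, diffR]
    push_cast
    ring
  · rintro e f hef rfl hf
    filter_upwards [Ioo_mem_nhdsGT (csrc_lt_ctgt N e),
      hf ▸ Ioo_mem_nhdsGT (csrc_lt_ctgt N f)] with x h1 h2
    exact height_ne hef h1 (by rwa [hf])

theorem diffL_eq_diffR (hR : IsGZ N α R) (hB : IsGZ N β B) {v : ℝ × ℝ} (hv : 0 < v.1)
    (h1 : ∀ t ∈ sinkPts N α, t.1 = v.1 → t.2 ≤ v.2)
    (h2 : ∀ t ∈ sinkPts N β, t.1 = v.1 → t.2 ≤ v.2) : diffL R B v = diffR R B v := by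
  rw [diffL, diffR, hR.aboveL_eq_aboveR hv h1, hB.aboveL_eq_aboveR hv h2]

end Vertex

/-! ### The number of edges above the sources and the sinks -/

section Count

variable {α : Fin k → ℕ} {A : Finset (CEdge N)}

/-- Conservation of flow on the half-plane left of `x`: each path either has reached its sink or
still crosses to the right. -/
theorem IsGZ.card_right (h : IsGZ N α A) (hn : ∑ i, α i ≤ n) {x : ℝ} (hx : 0 ≤ x) :
    (A.filter fun f => (csrc N f).1 ≤ x ∧ x < (ctgt N f).1).card +
      ((sinkPts N α).filter fun t => t.1 ≤ x).card = ∑ i, α i := by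
  have h1 := h.card_filter fun v => v.1 ≤ x
  have h2 : ((sourcePts n (∑ i, α i)).filter fun v => v.1 ≤ x).card = ∑ i, α i := by
    rw [Finset.filter_true_of_mem fun v hv => (sourcePts_fst hv).trans_le hx, card_sourcePts hn]
  have h3 : (A.filter fun f => (csrc N f).1 ≤ x).card =
      (A.filter fun f => (csrc N f).1 ≤ x ∧ x < (ctgt N f).1).card +
      (A.filter fun f => (ctgt N f).1 ≤ x).card := by
    classical
    rw [← Finset.card_union_of_disjoint]
    · congr 1
      ext f
      simp only [Finset.mem_filter, Finset.mem_union]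
      constructor
      · rintro ⟨hf, h4⟩
        rcases lt_or_ge x (ctgt N f).1 with h5 | h5
        · exact Or.inl ⟨hf, h4, h5⟩
        · exact Or.inr ⟨hf, h5⟩
      · rintro (⟨hf, h4, -⟩ | ⟨hf, h4⟩)
        · exact ⟨hf, h4⟩
        · exact ⟨hf, (csrc_lt_ctgt N f).le.trans h4⟩
    · refine Finset.disjoint_left.2 fun f hf hf' => ?_
      exact absurd (Finset.mem_filter.1 hf').2 (not_le.2 (Finset.mem_filter.1 hf).2.2)
  omega

theorem card_sinkPts_le (α : Fin k → ℕ) (q : Fin k) :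
    ((sinkPts N α).filter fun t => t.1 ≤ vertical N (q + 1)).card +
      ∑ p with q < p, α p = ∑ p, α p := by
  rw [Finset.card_filter, sum_sinkPts,
    ← Finset.sum_filter_add_sum_filter_not Finset.univ (fun p => q < p) α, add_comm]
  congr 1
  rw [Finset.sum_filter]
  refine Finset.sum_congr rfl fun p _ => ?_
  simp only [vertical_succ_le_iff, not_lt]
  split_ifs <;> simp

/-- No edge leaves a sink, so every edge leaving the line starts above height `α q`. The count is
thus that of all paths with a sink on a later line. -/
theorem IsGZ.aboveR_vertical (h : IsGZ N α A) (hn : ∑ i, α i ≤ n) (q : Fin k) :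
    aboveR A (vertical N (q + 1)) (α q) = ∑ p with q < p, α p := by
  have h1 := h.card_right hn (vertical_succ_pos N q).le
  have h2 := card_sinkPts_le (N := N) α q
  have h3 : aboveR A (vertical N (q + 1)) (α q) = (A.filter fun f =>
      (csrc N f).1 ≤ vertical N (q + 1) ∧ vertical N (q + 1) < (ctgt N f).1).card := by
    rw [aboveR]
    congr 1
    ext f
    simp only [Finset.mem_filter]
    refine ⟨fun h => ⟨h.1, h.2.1⟩, fun h' => ⟨h'.1, h'.2, ?_⟩⟩
    obtain ⟨h4, c, hc, h5⟩ := csrc_eq_vertical (j := q + 1) h'.2.1 h'.2.2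
    rw [← h4, height_csrc, h5, Nat.cast_lt]
    by_contra! h6
    exact (isGZ_iff.1 h).2.2.1 f h'.1 (mem_sinkPts.2 ⟨q, c, hc, h6, Prod.ext h4 h5⟩)
  omega

theorem IsGZ.aboveR_zero (h : IsGZ N α A) (hn : ∑ i, α i ≤ n) :
    aboveR A 0 ((n - ∑ i, α i : ℕ) : ℝ) = ∑ i, α i := by
  have h1 := h.card_right hn le_rfl
  have h2 : ((sinkPts N α).filter fun t => t.1 ≤ 0).card = 0 :=
    Finset.card_eq_zero.2 (Finset.filter_eq_empty_iff.2 fun t ht h =>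
      absurd (sinkPts_pos ht) (not_lt.2 h))
  have h3 : aboveR A 0 ((n - ∑ i, α i : ℕ) : ℝ) = (A.filter fun f =>
      (csrc N f).1 ≤ 0 ∧ 0 < (ctgt N f).1).card := by
    rw [aboveR]
    congr 1
    ext f
    simp only [Finset.mem_filter]
    refine ⟨fun h => ⟨h.1, h.2.1⟩, fun h' => ⟨h'.1, h'.2, ?_⟩⟩
    have h0 : (csrc N f).1 = 0 := le_antisymm h'.2.1 (csrc_nonneg f)
    rcases ((isGZ_iff.1 h).2.2.2 (csrc N f)).1 (Or.inl ⟨f, h'.1, rfl⟩) with h4 | ⟨g, -, h4⟩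
    · obtain ⟨a, ha, -, h5⟩ := mem_sourcePts.1 h4
      have h6 : height f 0 = a := by
        rw [← h0, height_csrc, h5]
      rw [h6, Nat.cast_lt]
      omega
    · have := ctgt_pos g
      rw [h4, h0] at this
      exact absurd this (lt_irrefl _)
  omega

-- Edges leaving a vertical line start at integer heights, so one unit up only those starting at
-- height `a + 1` are lost.
open Classical in
theorem aboveR_succ (A : Finset (CEdge N)) (j a : ℕ) :
    aboveR A (vertical N j) ((a + 1 : ℕ) : ℝ) +
      (A.filter fun f => csrc N f = (vertical N j, ((a + 1 : ℕ) : ℝ))).card =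
      aboveR A (vertical N j) a := by
  rw [aboveR, aboveR, ← Finset.card_union_of_disjoint]
  · congr 1
    ext f
    simp only [Finset.mem_filter, Finset.mem_union]
    constructor
    · rintro (⟨hf, h1, h2⟩ | ⟨hf, h1⟩)
      · exact ⟨hf, h1, lt_trans (Nat.cast_lt.2 (Nat.lt_succ_self a)) h2⟩
      · have h2 : (csrc N f).1 = vertical N j := congrArg Prod.fst h1
        refine ⟨hf, ⟨h2.le, h2 ▸ csrc_lt_ctgt N f⟩, ?_⟩
        rw [← h2, height_csrc, h1, Nat.cast_lt]
        exact Nat.lt_succ_self a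
    · rintro ⟨hf, h1, h2⟩
      obtain ⟨h3, c, -, h4⟩ := csrc_eq_vertical h1.1 h1.2
      have h5 : height f (vertical N j) = c := by rw [← h3, height_csrc, h4]
      rw [h5, Nat.cast_lt] at h2
      rcases (Nat.succ_le_of_lt h2).lt_or_eq with h6 | h6
      · exact Or.inl ⟨hf, h1, by rw [h5, Nat.cast_lt]; exact h6⟩
      · exact Or.inr ⟨hf, Prod.ext h3 (by rw [h4, ← h6])⟩
  · refine Finset.disjoint_left.2 fun f hf hf' => ?_
    have h1 := (Finset.mem_filter.1 hf).2.2
    have h2 := (Finset.mem_filter.1 hf').2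
    have h3 : (csrc N f).1 = vertical N j := congrArg Prod.fst h2
    rw [← h3, height_csrc, h2] at h1
    exact lt_irrefl _ h1

theorem aboveR_succ_of_forall_ne {j a : ℕ}
    (h : ∀ f ∈ A, csrc N f ≠ (vertical N j, ((a + 1 : ℕ) : ℝ))) :
    aboveR A (vertical N j) ((a + 1 : ℕ) : ℝ) = aboveR A (vertical N j) a := by
  classical
  rw [← aboveR_succ A j a, Finset.filter_false_of_mem h, Finset.card_empty, add_zero]

theorem IsGZ.aboveR_succ_of_mem (h : IsGZ N α A) {j a : ℕ} {f : CEdge N} (hf : f ∈ A)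
    (hfv : csrc N f = (vertical N j, ((a + 1 : ℕ) : ℝ))) :
    aboveR A (vertical N j) ((a + 1 : ℕ) : ℝ) + 1 = aboveR A (vertical N j) a := by
  classical
  rw [← aboveR_succ A j a]
  congr 1
  have := card_filter_of_unique (isGZ_iff.1 h).1 hf hfv fun _ => True
  simpa using this.symm

end Count

/-! ### Exchanging the edges of a given level -/

/-- The number of sinks is increased on the lines in `J`. -/
def bump (γ : Fin k → ℕ) (J : Finset (Fin k)) (q : Fin k) : ℕ :=
  γ q + if q ∈ J then 1 else 0

theorem bump_of_mem {γ : Fin k → ℕ} {J : Finset (Fin k)} {q : Fin k} (h : q ∈ J) :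
    bump γ J q = γ q + 1 := by simp [bump, h]

theorem bump_of_notMem {γ : Fin k → ℕ} {J : Finset (Fin k)} {q : Fin k} (h : q ∉ J) :
    bump γ J q = γ q := by simp [bump, h]

/-- The first point above the sinks `1, …, γ q`. -/
noncomputable def nextPt (N : Fin k → PlanarNetwork n) (γ : Fin k → ℕ) (q : Fin k) : ℝ × ℝ :=
  (vertical N (q + 1), ((γ q + 1 : ℕ) : ℝ))

theorem mem_sinkPts_bump {γ : Fin k → ℕ} {J : Finset (Fin k)} {v : ℝ × ℝ} :
    v ∈ sinkPts N (bump γ J) ↔ v ∈ sinkPts N γ ∨ ∃ q ∈ J, v = nextPt N γ q := by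
  simp only [mem_sinkPts, bump, nextPt]
  constructor
  · rintro ⟨i, b, h1, h2, rfl⟩
    split_ifs at h2 with hi
    · rcases h2.lt_or_eq with h2 | rfl
      · exact Or.inl ⟨i, b, h1, Nat.lt_succ_iff.1 h2, rfl⟩
      · exact Or.inr ⟨i, hi, rfl⟩
    · exact Or.inl ⟨i, b, h1, h2, rfl⟩
  · rintro (⟨i, b, h1, h2, rfl⟩ | ⟨i, hi, rfl⟩)
    · exact ⟨i, b, h1, by omega, rfl⟩
    · exact ⟨i, γ i + 1, by omega, by simp [hi], rfl⟩

theorem nextPt_injective (γ : Fin k → ℕ) {p q : Fin k} (h : nextPt N γ p = nextPt N γ q) :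
    p = q := vertical_succ_injective (Prod.mk.inj h).1

/-- The level given to the edge without target at `nextPt N γ q`. -/
def sinkLevel (γ : Fin k → ℕ) (JR JB : Finset (Fin k)) (q : Fin k) : ℤ :=
  (∑ p with q < p, bump γ JB p : ℕ) - (∑ p with q < p, bump γ JR p : ℕ) + if q ∈ JB then 1 else 0

/-- The edges of level `c`. -/
def levelSet (R B : Finset (CEdge N)) (γ : Fin k → ℕ) (JR JB : Finset (Fin k)) (c : ℤ) :
    Set (CEdge N ⊕ ℝ × ℝ) :=
  {z | Sum.elim (fun e => level R B e = c)
    (fun t => ∃ q, t = nextPt N γ q ∧ sinkLevel γ JR JB q = c) z}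

theorem inl_mem_levelSet {R B : Finset (CEdge N)} {γ : Fin k → ℕ} {JR JB : Finset (Fin k)} {c : ℤ}
    {e : CEdge N} : Sum.inl e ∈ levelSet R B γ JR JB c ↔ level R B e = c := Iff.rfl

theorem nextPt_mem_levelSet {R B : Finset (CEdge N)} {γ : Fin k → ℕ} {JR JB : Finset (Fin k)}
    {c : ℤ} {q : Fin k} :
    Sum.inr (nextPt N γ q) ∈ levelSet R B γ JR JB c ↔ sinkLevel γ JR JB q = c :=
  ⟨fun ⟨_, h1, h2⟩ => nextPt_injective γ h1 ▸ h2, fun h => ⟨q, rfl, h⟩⟩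

section Switch

variable {γ : Fin k → ℕ} {JR JB : Finset (Fin k)} {R B : Finset (CEdge N)}

theorem eq_nextPt {v : ℝ × ℝ} (h1 : v ∈ sinkPts N (bump γ JR)) (h2 : v ∉ sinkPts N (bump γ JB)) :
    ∃ q ∈ JR, q ∉ JB ∧ v = nextPt N γ q := by
  rw [mem_sinkPts_bump] at h1 h2
  push Not at h2
  obtain ⟨q, hq, rfl⟩ := h1.resolve_left h2.1
  exact ⟨q, hq, fun h => h2.2 q h rfl, rfl⟩

theorem sinkPts_le_nextPt {J : Finset (Fin k)} {q : Fin k} {t : ℝ × ℝ}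
    (ht : t ∈ sinkPts N (bump γ J)) (h : t.1 = (nextPt N γ q).1) : t.2 ≤ (nextPt N γ q).2 := by
  obtain ⟨p, b, -, hb, rfl⟩ := mem_sinkPts.1 ht
  obtain rfl := vertical_succ_injective h
  simp only [nextPt, bump] at hb ⊢
  rw [Nat.cast_le]
  split_ifs at hb <;> omega

theorem nextPt_pos (γ : Fin k → ℕ) (q : Fin k) : 0 < (nextPt N γ q).1 := vertical_succ_pos N q

/-- An edge of `R` arriving at a sink of `R` that is not on `B`. -/
theorem level_left_of_sink (hR : IsGZ N (bump γ JR) R) (hB : IsGZ N (bump γ JB) B)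
    (hRn : ∑ i, bump γ JR i ≤ n) (hBn : ∑ i, bump γ JB i ≤ n) {q : Fin k} (hq : q ∈ JR)
    (hq' : q ∉ JB) (hb : ∀ b ∈ B, csrc N b ≠ nextPt N γ q) :
    diffL R B (nextPt N γ q) = sinkLevel γ JR JB q := by
  rw [diffL_eq_diffR hR hB (nextPt_pos γ q) (fun t => sinkPts_le_nextPt)
    (fun t => sinkPts_le_nextPt), diffR, sinkLevel, if_neg hq', ← hR.aboveR_vertical hRn,
    ← hB.aboveR_vertical hBn, bump_of_mem hq, bump_of_notMem hq', nextPt,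
    aboveR_succ_of_forall_ne hb]
  ring

/-- An edge of `B` starting from a sink of `R`. -/
theorem level_right_of_sink (hR : IsGZ N (bump γ JR) R) (hB : IsGZ N (bump γ JB) B)
    (hRn : ∑ i, bump γ JR i ≤ n) (hBn : ∑ i, bump γ JB i ≤ n) {q : Fin k} (hq : q ∈ JR)
    (hq' : q ∉ JB) {b : CEdge N} (hb : b ∈ B) (hbq : csrc N b = nextPt N γ q) :
    diffR R B (nextPt N γ q) + 1 = sinkLevel γ JR JB q := by
  have h := hB.aboveR_succ_of_mem hb hbq
  rw [diffR, sinkLevel, if_neg hq', ← hR.aboveR_vertical hRn, ← hB.aboveR_vertical hBn,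
    bump_of_mem hq, bump_of_notMem hq', nextPt, ← h]
  push_cast
  ring

/-- An edge of `B` arriving at a sink of `B` that is not on `R`. -/
theorem level_left_of_sink' (hR : IsGZ N (bump γ JR) R) (hB : IsGZ N (bump γ JB) B)
    (hRn : ∑ i, bump γ JR i ≤ n) (hBn : ∑ i, bump γ JB i ≤ n) {q : Fin k} (hq : q ∈ JB)
    (hq' : q ∉ JR) (hr : ∀ r ∈ R, csrc N r ≠ nextPt N γ q) :
    diffL R B (nextPt N γ q) + 1 = sinkLevel γ JR JB q := by
  rw [diffL_eq_diffR hR hB (nextPt_pos γ q) (fun t => sinkPts_le_nextPt)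
    (fun t => sinkPts_le_nextPt), diffR, sinkLevel, if_pos hq, ← hR.aboveR_vertical hRn,
    ← hB.aboveR_vertical hBn, bump_of_mem hq, bump_of_notMem hq', nextPt,
    aboveR_succ_of_forall_ne hr]

/-- An edge of `R` starting from a sink of `B`. -/
theorem level_right_of_sink' (hR : IsGZ N (bump γ JR) R) (hB : IsGZ N (bump γ JB) B)
    (hRn : ∑ i, bump γ JR i ≤ n) (hBn : ∑ i, bump γ JB i ≤ n) {q : Fin k} (hq : q ∈ JB)
    (hq' : q ∉ JR) {r : CEdge N} (hr : r ∈ R) (hrq : csrc N r = nextPt N γ q) :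
    diffR R B (nextPt N γ q) = sinkLevel γ JR JB q := by
  have h := hR.aboveR_succ_of_mem hr hrq
  rw [diffR, sinkLevel, if_pos hq, ← hR.aboveR_vertical hRn, ← hB.aboveR_vertical hBn,
    bump_of_mem hq, bump_of_notMem hq', nextPt, ← h]
  push_cast
  ring

theorem IsGZ.exists_csrc {α : Fin k → ℕ} {A : Finset (CEdge N)} (h : IsGZ N α A) {e : CEdge N}
    (he : e ∈ A) : (∃ f ∈ A, csrc N f = ctgt N e) ∨ ctgt N e ∈ sinkPts N α :=
  ((isGZ_iff.1 h).2.2.2 _).2 (Or.inr ⟨e, he, rfl⟩)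

theorem IsGZ.ctgt_ne {α : Fin k → ℕ} {A : Finset (CEdge N)} (h : IsGZ N α A) {v : ℝ × ℝ}
    (h1 : ∀ f ∈ A, csrc N f ≠ v) (h2 : v ∉ sinkPts N α) : ∀ e ∈ A, ctgt N e ≠ v := by
  rintro e he rfl
  rcases h.exists_csrc he with ⟨f, hf, h3⟩ | h3
  · exact h1 f hf h3
  · exact h2 h3

theorem forall_disjSum_ne {A : Finset (CEdge N)} {T : Finset (ℝ × ℝ)} {v : ℝ × ℝ} :
    (∀ z ∈ A.disjSum T, extSrc N z ≠ v) ↔ (∀ e ∈ A, csrc N e ≠ v) ∧ v ∉ T := by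
  refine ⟨fun h => ⟨fun e he => h (.inl e) (Finset.inl_mem_disjSum.2 he),
    fun hv => h (.inr v) (Finset.inr_mem_disjSum.2 hv) rfl⟩, fun ⟨h1, h2⟩ => ?_⟩
  rintro (e | t) hz h
  · exact h1 e (Finset.inl_mem_disjSum.1 hz) h
  · exact h2 (h ▸ Finset.inr_mem_disjSum.1 hz)

/-- The local comparison of levels gives the conditions at ordinary vertices. At a sink of only one
family, `sinkLevel` is the value matching the edge that arrives at this sink or leaves it. The
condition `c ≠ 1` protects the additional source of `B`. -/
theorem isSwitch_levelSet (hR : IsGZ N (bump γ JR) R) (hB : IsGZ N (bump γ JB) B)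
    (hsum : ∑ i, bump γ JR i + 1 = ∑ i, bump γ JB i) (hBn : ∑ i, bump γ JB i ≤ n) {c : ℤ}
    (hc : c ≠ 1) :
    IsSwitch (extSrc N) (extTgt N) (R.disjSum (sinkPts N (bump γ JR)))
      (B.disjSum (sinkPts N (bump γ JB))) (sourcePts n (∑ i, bump γ JR i))
      (sourcePts n (∑ i, bump γ JB i)) (levelSet R B γ JR JB c) (levelSet R B γ JR JB c) where
  src_iff := by
    have hRn : ∑ i, bump γ JR i ≤ n := by omega
    rintro (r | t) hr (b | u) hb h
    · rw [Finset.inl_mem_disjSum] at hr hb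
      rw [inl_mem_levelSet, inl_mem_levelSet, (level_of_csrc hR hB _).1 r hr b hb h rfl]
    · rw [Finset.inl_mem_disjSum] at hr
      rw [Finset.inr_mem_disjSum] at hb
      simp only [extSrc_inl, extSrc_inr] at h
      subst h
      obtain ⟨q, hq, hq', hv⟩ := eq_nextPt hb ((isGZ_iff.1 hR).2.2.1 r hr)
      rw [inl_mem_levelSet, (level_of_csrc hR hB _).2.1 r hr hv fun b hb' h =>
        (isGZ_iff.1 hB).2.2.1 b hb' (by rwa [h, ← hv]),
        level_right_of_sink' hR hB hRn hBn hq hq' hr hv, hv, nextPt_mem_levelSet]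
    · rw [Finset.inl_mem_disjSum] at hb
      rw [Finset.inr_mem_disjSum] at hr
      simp only [extSrc_inl, extSrc_inr] at h
      subst h
      obtain ⟨q, hq, hq', hv⟩ := eq_nextPt hr ((isGZ_iff.1 hB).2.2.1 b hb)
      rw [inl_mem_levelSet, (level_of_csrc hR hB _).2.2 b hb hv fun r hr' h =>
        (isGZ_iff.1 hR).2.2.1 r hr' (by rwa [h, ← hv]),
        level_right_of_sink hR hB hRn hBn hq hq' hb hv, hv, nextPt_mem_levelSet]
    · cases h
      rfl
  tgt_iff := by
    rintro (r | t) hr (b | u) hb v hrv hbv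
    · rw [Finset.inl_mem_disjSum] at hr hb
      rw [inl_mem_levelSet, inl_mem_levelSet, (level_of_ctgt hR hB v).1 r hr b hb
        (Option.some.inj hrv) (Option.some.inj hbv)]
    · cases hbv
    · cases hrv
    · cases hrv
  left := by
    have hRn : ∑ i, bump γ JR i ≤ n := by omega
    rintro (r | t) hr (r' | t') hr' h hnb
    · rw [Finset.inl_mem_disjSum] at hr hr'
      have h : ctgt N r = csrc N r' := Option.some.inj h
      obtain ⟨hb1, hb2⟩ := forall_disjSum_ne.1 hnb
      have hb3 := hB.ctgt_ne hb1 hb2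
      rw [inl_mem_levelSet, inl_mem_levelSet, (level_of_ctgt hR hB _).2.1 r hr h hb3,
        (level_of_csrc hR hB _).2.1 r' hr' rfl hb1, diffL_eq_diffR hR hB
          (h ▸ ctgt_pos r) (fun t => sinkPts_le_csrc ((isGZ_iff.1 hR).2.2.1 r' hr'))
          (fun t => sinkPts_le_csrc hb2)]
    · rw [Finset.inl_mem_disjSum] at hr
      rw [Finset.inr_mem_disjSum] at hr'
      have h : ctgt N r = t' := Option.some.inj h
      obtain ⟨hb1, hb2⟩ := forall_disjSum_ne.1 hnb
      have hb3 := hB.ctgt_ne hb1 hb2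
      obtain ⟨q, hq, hq', rfl⟩ := eq_nextPt hr' hb2
      rw [inl_mem_levelSet, nextPt_mem_levelSet, (level_of_ctgt hR hB _).2.1 r hr h hb3,
        level_left_of_sink hR hB hRn hBn hq hq' hb1]
    · cases h
    · cases h
  right := by
    have hRn : ∑ i, bump γ JR i ≤ n := by omega
    rintro (b | t) hb (b' | t') hb' h hnr
    · rw [Finset.inl_mem_disjSum] at hb hb'
      have h : ctgt N b = csrc N b' := Option.some.inj h
      obtain ⟨hr1, hr2⟩ := forall_disjSum_ne.1 hnr
      have hr3 := hR.ctgt_ne hr1 hr2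
      rw [inl_mem_levelSet, inl_mem_levelSet, (level_of_ctgt hR hB _).2.2 b hb h hr3,
        (level_of_csrc hR hB _).2.2 b' hb' rfl hr1, diffL_eq_diffR hR hB
          (h ▸ ctgt_pos b) (fun t => sinkPts_le_csrc hr2)
          (fun t => sinkPts_le_csrc ((isGZ_iff.1 hB).2.2.1 b' hb'))]
    · rw [Finset.inl_mem_disjSum] at hb
      rw [Finset.inr_mem_disjSum] at hb'
      have h : ctgt N b = t' := Option.some.inj h
      obtain ⟨hr1, hr2⟩ := forall_disjSum_ne.1 hnr
      have hr3 := hR.ctgt_ne hr1 hr2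
      obtain ⟨q, hq, hq', rfl⟩ := eq_nextPt hb' hr2
      rw [inl_mem_levelSet, nextPt_mem_levelSet, (level_of_ctgt hR hB _).2.2 b hb h hr3,
        level_left_of_sink' hR hB hRn hBn hq hq' hr1]
    · cases h
    · cases h
  start_left r _ h1 h2 := absurd (sourcePts_mono (by omega) h1) h2
  start_right := by
    have hRn : ∑ i, bump γ JR i ≤ n := by omega
    rintro (b | t) hb h1 h2
    · rw [Finset.inl_mem_disjSum] at hb
      rw [extSrc_inl] at h1 h2
      obtain ⟨a, ha1, ha2, hv⟩ := mem_sourcePts.1 h1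
      -- This source lies just below those of `R`. Above it start all paths of `R` and all other
      -- paths of `B`, equally many, so the edge of `B` leaving it has level `0 + 1`.
      have ha : a = n - ∑ i, bump γ JB i + 1 := by
        by_contra ha
        exact h2 (mem_sourcePts.2 ⟨a, by omega, ha2, hv⟩)
      have ha' : a = n - ∑ i, bump γ JR i := by omega
      have hr : ∀ r ∈ R, csrc N r ≠ csrc N b := by
        intro r hr h
        rcases ((isGZ_iff.1 hR).2.2.2 _).1 (Or.inl ⟨r, hr, h⟩) with h3 | ⟨f, -, h3⟩
        · exact h2 h3
        · have := ctgt_pos f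
          rw [h3, hv] at this
          exact lt_irrefl _ this
      have h3 := hB.aboveR_succ_of_mem (j := 0) (a := n - ∑ i, bump γ JB i) hb
        (by rw [hv, vertical_zero, ha])
      rw [vertical_zero, hB.aboveR_zero hBn, ← ha] at h3
      have h4 := hR.aboveR_zero hRn
      rw [← ha'] at h4
      have h5 : diffR R B (csrc N b) = 0 := by
        rw [diffR, hv]
        simp only
        omega
      rw [inl_mem_levelSet, (level_of_csrc hR hB _).2.2 b hb rfl hr, h5]
      exact fun h => hc (by omega)
    · rw [Finset.inr_mem_disjSum] at hb
      exact absurd (sourcePts_fst h1) (sinkPts_pos hb).ne'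

end Switch

end PlanarNetwork

/-! ### From exchanges to inequalities between products of path families -/

namespace PlanarNetwork

variable {n k : ℕ} {N : Fin k → PlanarNetwork n}

theorem IsGZ.extTgt_ne {α : Fin k → ℕ} {A : Finset (CEdge N)} (_ : IsGZ N α A) {s : ℕ} :
    ∀ v ∈ sourcePts n s, ∀ z ∈ A.disjSum (sinkPts N α), extTgt N z ≠ some v := by
  rintro v hv (e | t) - h
  · have := ctgt_pos e
    rw [Option.some.inj h, sourcePts_fst hv] at this
    exact lt_irrefl _ this
  · cases h

theorem card_sinkPts (α : Fin k → ℕ) : (sinkPts N α).card = ∑ i, α i := by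
  rw [Finset.card_eq_sum_ones, sum_sinkPts]
  simp

/-- Conservation of flow over all vertices: every path that starts must finish at a formal sink
edge. -/
theorem sum_eq_of_isLinkage {α : Fin k → ℕ} {A : Finset (CEdge N)} {s : ℕ} (hs : s ≤ n)
    (h : IsLinkage (extSrc N) (extTgt N) (A.disjSum (sinkPts N α)) (sourcePts n s)) :
    ∑ i, α i = s := by
  have h1 := h.card_filter_src fun _ => True
  simp only [Finset.card_filter, Finset.sum_disjSum, extTgt_inl, extTgt_inr, Option.some.injEq,
    exists_eq_left', reduceCtorEq, false_and, exists_false, if_true, if_false,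
    Finset.sum_const_zero, add_zero, ← Finset.card_eq_sum_ones, Finset.card_disjSum,
    card_sourcePts hs] at h1
  rw [card_sinkPts] at h1
  omega

section

variable {γ : Fin k → ℕ} {JR JB K : Finset (Fin k)} {R B : Finset (CEdge N)}
  {X Y : Set (CEdge N ⊕ ℝ × ℝ)}

/-- Exchanging parts of two multipaths exchanges some of their sinks. -/
theorem exists_isGZ_switch (hR : IsGZ N (bump γ JR) R) (hB : IsGZ N (bump γ JB) B)
    (hRn : ∑ i, bump γ JR i ≤ n)
    (h : IsSwitch (extSrc N) (extTgt N) (R.disjSum (sinkPts N (bump γ JR)))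
      (B.disjSum (sinkPts N (bump γ JB))) (sourcePts n (∑ i, bump γ JR i))
      (sourcePts n (∑ i, bump γ JB i)) X Y)
    (hX : ∀ q ∈ JR, (Sum.inr (nextPt N γ q) ∈ X ↔ q ∈ K))
    (hY : ∀ q ∈ JB, (Sum.inr (nextPt N γ q) ∈ Y ↔ q ∈ K)) :
    ∃ A, IsGZ N (bump γ (JR \ K ∪ JB ∩ K)) A ∧
      ∑ i, bump γ (JR \ K ∪ JB ∩ K) i = ∑ i, bump γ JR i ∧
      switch (R.disjSum (sinkPts N (bump γ JR))) (B.disjSum (sinkPts N (bump γ JB))) X Y =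
        A.disjSum (sinkPts N (bump γ (JR \ K ∪ JB ∩ K))) := by
  have h1 := IsLinkage.switch hR hB hB.extTgt_ne hR.extTgt_ne h
  have h2 : (switch (R.disjSum (sinkPts N (bump γ JR)))
      (B.disjSum (sinkPts N (bump γ JB))) X Y).toRight =
      sinkPts N (bump γ (JR \ K ∪ JB ∩ K)) := by
    ext t
    rw [Finset.mem_toRight, mem_switch, Finset.inr_mem_disjSum, Finset.inr_mem_disjSum,
      mem_sinkPts_bump, mem_sinkPts_bump, mem_sinkPts_bump]
    by_cases ht : t ∈ sinkPts N γ
    -- A sink common to both families survives whether or not it is exchanged, since its formal edge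
    -- lies in `X` exactly when it lies in `Y`.
    · have := h.src_iff (.inr t) (Finset.inr_mem_disjSum.2 (mem_sinkPts_bump.2 (Or.inl ht)))
        (.inr t) (Finset.inr_mem_disjSum.2 (mem_sinkPts_bump.2 (Or.inl ht))) rfl
      simp only [ht, true_or, true_and, iff_true, this]
      exact (em _).symm
    · simp only [ht, false_or, Finset.mem_union, Finset.mem_sdiff, Finset.mem_inter]
      constructor
      · rintro (⟨⟨q, hq, rfl⟩, hq'⟩ | ⟨⟨q, hq, rfl⟩, hq'⟩)
        · exact ⟨q, Or.inl ⟨hq, fun h => hq' ((hX q hq).2 h)⟩, rfl⟩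
        · exact ⟨q, Or.inr ⟨hq, (hY q hq).1 hq'⟩, rfl⟩
      · rintro ⟨q, ⟨hq, hq'⟩ | ⟨hq, hq'⟩, rfl⟩
        · exact Or.inl ⟨⟨q, hq, rfl⟩, fun h => hq' ((hX q hq).1 h)⟩
        · exact Or.inr ⟨⟨q, hq, rfl⟩, (hY q hq).2 hq'⟩
  have h3 := h2 ▸ (Finset.toLeft_disjSum_toRight (u := switch
    (R.disjSum (sinkPts N (bump γ JR))) (B.disjSum (sinkPts N (bump γ JB))) X Y)).symm
  rw [h3] at h1
  have h4 := sum_eq_of_isLinkage hRn h1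
  exact ⟨_, by rw [IsGZ, h4]; exact h1, h4, h3⟩

/-- With weight `0` on the formal sink edges, the exchange preserves the total weight, and both new
families compete for the corresponding maxima. The equality of sums records that the first new
family keeps its number of sinks. -/
theorem sum_add_sum_le_m_add_m {w : ∀ i, (N i).Weighting}
    (hRn : ∑ i, bump γ JR i ≤ n) (hBn : ∑ i, bump γ JB i ≤ n)
    (hR : IsGZ N (bump γ JR) R) (hB : IsGZ N (bump γ JB) B)
    (h : IsSwitch (extSrc N) (extTgt N) (R.disjSum (sinkPts N (bump γ JR)))
      (B.disjSum (sinkPts N (bump γ JB))) (sourcePts n (∑ i, bump γ JR i))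
      (sourcePts n (∑ i, bump γ JB i)) X Y)
    (hX : ∀ q ∈ JR, (Sum.inr (nextPt N γ q) ∈ X ↔ q ∈ K))
    (hY : ∀ q ∈ JB, (Sum.inr (nextPt N γ q) ∈ Y ↔ q ∈ K)) :
    ∑ i, bump γ (JR \ K ∪ JB ∩ K) i = ∑ i, bump γ JR i ∧
    ∑ e ∈ R, w e.1 e.2 + ∑ e ∈ B, w e.1 e.2 ≤
      m N w (bump γ (JR \ K ∪ JB ∩ K)) + m N w (bump γ (JB \ K ∪ JR ∩ K)) := by
  obtain ⟨A, h1, h2, h3⟩ := exists_isGZ_switch hR hB hRn h hX hY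
  obtain ⟨A', h1', h2', h3'⟩ := exists_isGZ_switch hB hR hBn h.symm hY hX
  have h4 := h.sum_add_sum (Sum.elim (fun e => w e.1 e.2) fun _ => (0 : WithBot ℝ))
  rw [h3, h3'] at h4
  simp only [Finset.sum_disjSum, Sum.elim_inl, Sum.elim_inr, Finset.sum_const_zero, add_zero] at h4
  exact ⟨h2, h4 ▸ add_le_add (h1.sum_le_m (h2 ▸ hRn) w) (h1'.sum_le_m (h2' ▸ hBn) w)⟩

end

end PlanarNetwork

/-! ### The two exchange inequalities and the octahedron recurrence -/

namespace PlanarNetwork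

variable {n k : ℕ} {N : Fin k → PlanarNetwork n}

/-- Exchanging the edges of level `c` of two multipaths of maximal weight. -/
theorem MultiGZ.m_add_m_le_of_level {w : ∀ i, (N i).Weighting} (h : MultiGZ N w)
    {γ : Fin k → ℕ} {JR JB : Finset (Fin k)}
    (hsum : ∑ i, bump γ JR i + 1 = ∑ i, bump γ JB i) (hBn : ∑ i, bump γ JB i ≤ n) {c : ℤ}
    (hc : c ≠ 1) (K : Finset (Fin k)) (hK : ∀ q, sinkLevel γ JR JB q = c ↔ q ∈ K) :
    m N w (bump γ JR) + m N w (bump γ JB) ≤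
      m N w (bump γ (JR \ K ∪ JB ∩ K)) + m N w (bump γ (JB \ K ∪ JR ∩ K)) := by
  have hRn : ∑ i, bump γ JR i ≤ n := by omega
  obtain ⟨R, hR, hRw⟩ := h.exists_isGZ hRn
  obtain ⟨B, hB, hBw⟩ := h.exists_isGZ hBn
  rw [hRw, hBw]
  exact (sum_add_sum_le_m_add_m hRn hBn hR hB (isSwitch_levelSet hR hB hsum hBn hc)
    (fun q _ => nextPt_mem_levelSet.trans (hK q))
    (fun q _ => nextPt_mem_levelSet.trans (hK q))).2

/-- Exchanging the edges on an alternating walk between two multipaths of maximal weight. -/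
theorem MultiGZ.exists_m_add_m_le {w : ∀ i, (N i).Weighting} (h : MultiGZ N w)
    {γ : Fin k → ℕ} {JR JB : Finset (Fin k)} (hJ : Disjoint JR JB)
    (hsum : ∑ i, bump γ JR i ≤ ∑ i, bump γ JB i) (hBn : ∑ i, bump γ JB i ≤ n)
    {q : Fin k} (hq : q ∈ JR) :
    ∃ K : Finset (Fin k), q ∈ K ∧ ∑ i, bump γ (JR \ K ∪ JB ∩ K) i = ∑ i, bump γ JR i ∧
      m N w (bump γ JR) + m N w (bump γ JB) ≤
        m N w (bump γ (JR \ K ∪ JB ∩ K)) + m N w (bump γ (JB \ K ∪ JR ∩ K)) := by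
  classical
  have hRn : ∑ i, bump γ JR i ≤ n := by omega
  obtain ⟨R, hR, hRw⟩ := h.exists_isGZ hRn
  obtain ⟨B, hB, hBw⟩ := h.exists_isGZ hBn
  rw [hRw, hBw]
  have hs := isSwitch_altStep hR hB (sourcePts_mono hsum) hR.extTgt_ne
    (extTgt_inr (N := N) (nextPt N γ q))
  set X := {r | Relation.ReflTransGen (AltStep (extSrc N) (extTgt N)
    (R.disjSum (sinkPts N (bump γ JR))) (B.disjSum (sinkPts N (bump γ JB))))
    (.inl (.inr (nextPt N γ q))) (.inl r)}
  set Y := {r | Relation.ReflTransGen (AltStep (extSrc N) (extTgt N)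
    (R.disjSum (sinkPts N (bump γ JR))) (B.disjSum (sinkPts N (bump γ JB))))
    (.inl (.inr (nextPt N γ q))) (.inr r)}
  have hqX : Sum.inr (nextPt N γ q) ∈ X := Relation.ReflTransGen.refl
  -- As `JR` and `JB` are disjoint, membership in `K` means that the walk visits the sink edge in
  -- `X` for an index of `JR`, and in `Y` for an index of `JB`.
  refine ⟨Finset.univ.filter fun p => (p ∈ JR ∧ Sum.inr (nextPt N γ p) ∈ X) ∨
    (p ∈ JB ∧ Sum.inr (nextPt N γ p) ∈ Y), by simp [hq, hqX],
    sum_add_sum_le_m_add_m hRn hBn hR hB hs (fun p hp => ?_) fun p hp => ?_⟩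
  · simp [hp, Finset.disjoint_left.1 hJ hp]
  · simp [hp, Finset.disjoint_right.1 hJ hp]

theorem bump_fin_three (i j k : ℕ) (J : Finset (Fin 3)) : bump ![i, j, k] J =
    ![i + if 0 ∈ J then 1 else 0, j + if 1 ∈ J then 1 else 0, k + if 2 ∈ J then 1 else 0] := by
  funext q
  fin_cases q <;> rfl

end PlanarNetwork

theorem mainTheorem3 (n : ℕ) (N : Fin 3 → PlanarNetwork n) (w : ∀ s, (N s).Weighting)
    (hsingle : ∀ s : Fin 3, PlanarNetwork.MultiGZ (fun _ : Fin 1 => N s) (fun _ => w s))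
    (h12 : PlanarNetwork.MultiGZ (fun s : Fin 2 => N s.castSucc) (fun s => w s.castSucc))
    (h23 : PlanarNetwork.MultiGZ (fun s : Fin 2 => N s.succ) (fun s => w s.succ))
    (h123 : PlanarNetwork.MultiGZ N w)
    (i j k : ℕ) (hijk : i + j + k + 2 ≤ n) :
    PlanarNetwork.m N w ![i, j + 1, k] + PlanarNetwork.m N w ![i + 1, j, k + 1] =
      max (PlanarNetwork.m N w ![i + 1, j, k] + PlanarNetwork.m N w ![i, j + 1, k + 1])
        (PlanarNetwork.m N w ![i, j, k + 1] + PlanarNetwork.m N w ![i + 1, j + 1, k]) := by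
  open PlanarNetwork in
  apply le_antisymm
  · obtain ⟨K, hK, hs, hle⟩ := h123.exists_m_add_m_le (γ := ![i, j, k]) (JR := {1}) (JB := {0, 2})
      (by decide) (by simp [bump_fin_three, Fin.sum_univ_three]; omega)
      (by simp [bump_fin_three, Fin.sum_univ_three]; omega) (q := 1) (by decide)
    -- The sum in `hs` forces exactly one of `0`, `2` into `K`: with neither, the new `R` would have
    -- one sink too few, with both, one too many.
    by_cases h0 : 0 ∈ K <;> by_cases h2 : 2 ∈ K <;>
      simp [bump_fin_three, Fin.sum_univ_three, hK, h0, h2] at hs hle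
    · omega
    · exact hle.trans (le_max_left _ _)
    · exact hle.trans (le_max_right _ _)
  · apply max_le
    -- For these types the sink levels on the three lines are `2, 2, 1`, so level `2` exchanges the
    -- extra sinks of the first two lines.
    · have h := h123.m_add_m_le_of_level (γ := ![i, j, k]) (JR := {0}) (JB := {1, 2}) (c := 2)
        (by simp [bump_fin_three, Fin.sum_univ_three]; omega)
        (by simp [bump_fin_three, Fin.sum_univ_three]; omega) (by decide) {0, 1} fun q => by
          fin_cases q <;> simp [sinkLevel, Finset.sum_filter, Fin.sum_univ_three, bump_fin_three];
            omega
      simpa [bump_fin_three] using h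
    -- Here the sink levels are `1, 0, 0`, so level `0` exchanges the extra sinks of the last two
    -- lines.
    · have h := h123.m_add_m_le_of_level (γ := ![i, j, k]) (JR := {2}) (JB := {0, 1}) (c := 0)
        (by simp [bump_fin_three, Fin.sum_univ_three]; omega)
        (by simp [bump_fin_three, Fin.sum_univ_three]; omega) (by decide) {1, 2} fun q => by
          fin_cases q <;> simp [sinkLevel, Finset.sum_filter, Fin.sum_univ_three, bump_fin_three];
            omega
      simpa [bump_fin_three] using h
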